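/- Fix $h\in\mathbb{C}$ such that $q=e^{h}$ is not a root of unity, and write $q^{s}=e^{hs}$ for $s\in\mathbb{C}$. Let $\mathcal{U}=\mathcal{U}_q(\mathfrak{sl}(2))$ be the unital $\mathbb{C}$-algebra with generators $k^{\pm1},e,f$ and relations $kk^{-1}=k^{-1}k=1$, $ke=qek$, $kf=q^{-1}fk$, $ef-fe=\frac{k^{2}-k^{-2}}{q-q^{-1}}$. Let $\mathcal{A}=\mathcal{A}_q[\mathrm{SL}(2)]\subset\mathcal{U}^{*}$ be the span of the matrix coefficients of the finite-dimensional type 1 representations of $\mathcal{U}$ (those on which $k$ is diagonalizable with eigenvalues in $\{q^{r/2}: r\in\mathbb{Z}\}$), with its regular $(\mathcal{U}-\mathcal{U})$-bimodule structure $(u\cdot a\cdot u')(v)=a(u'vu)$. For $\alpha,\beta\in\mathbb{Z}$ let $\mathcal{A}[\alpha,\beta]$ be the set of $a\in\mathcal{A}$ with $k^{m}\cdot a=q^{m\beta/2}a$ and $a\cdot k^{m}=q^{m\alpha/2}a$ for all $m\in\mathbb{Z}$. Let $F$ be the field of meromorphic functions on $\mathbb{C}$ and $K=F\otimes_{\mathbb{C}}F$;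 for $g\in F$ write $g(\lambda)=g\otimes1$ and $g(\mu)=1\otimes g$ in $K$. Put $\mathcal{A}_K=K\otimes\mathcal{A}$, $\mathcal{A}_K[\alpha,\beta]=K\otimes\mathcal{A}[\alpha,\beta]$, and extend the left and right actions of $\mathcal{U}$ on $\mathcal{A}$ $K$-linearly to actions of $\mathcal{U}_K=K\otimes\mathcal{U}$ on $\mathcal{A}_K$. Let $$x(\lambda)=\sum_{l,m=0}^{\infty}\frac{(-q^{-\lambda})^{l+m}}{(q^{-2\lambda};q^{2})_{l}}\,\frac{q^{l^{2}-l+2lm-2m}(1-q^{2})^{l+m}}{(q^{2};q^{2})_{l}\,(q^{2};q^{2})_{m}}\,(fk^{-1})^{l}(ek^{-1})^{m},\qquad (a;p)_n=\prod_{j=0}^{n-1}(1-ap^{j}),$$ be Babelon's vertex-IRF transformation. The operators $a\mapsto x(\mu)\cdot a$ and $a\mapsto a\cdot x(\lambda)$ on $\mathcal{A}_K$ are defined by this sum, only finitely many terms of which are nonzero on any given $a$. Define $$\mathcal{A}^{x}_{\alpha\beta}=x^{-1}(\mu)\cdot\mathcal{A}_K[\alpha,\beta]\cdot x(\lambda),$$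 where $x^{-1}(\mu)\cdot$ denotes the inverse in $\mathrm{End}_K(\mathcal{A}_K)$ of the operator $a\mapsto x(\mu)\cdot a$. Finally let $$Y(\lambda)=fk-ek+\Bigl(\frac{q^{-\lambda-1}+q^{\lambda+1}}{q-q^{-1}}\Bigr)(k^{2}-1),\qquad \nu_\alpha(\lambda)=\frac{q^{-\lambda-1}(q^{-\alpha}-1)+q^{\lambda+1}(q^{\alpha}-1)}{q-q^{-1}}\in F\quad(\alpha\in\mathbb{Z}),$$ where $Y(\lambda)$ is Koornwinder's twisted primitive element. Then the operators $a\mapsto x(\mu)\cdot a$ and $a\mapsto a\cdot x(\lambda)$ are invertible in $\mathrm{End}_K(\mathcal{A}_K)$, and for all $\alpha,\beta\in\mathbb{Z}$, $$\mathcal{A}^{x}_{\alpha\beta}=\{a\in\mathcal{A}_K \mid Y(\mu)\cdot a=\nu_\beta(\mu)\,a,\quad a\cdot Y(\lambda)=\nu_\alpha(\lambda)\,a\}.$$ -/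

import Mathlib

open scoped TensorProduct

namespace SL2Dyn

noncomputable section

/-! ### Meromorphic functions on the complex plane -/

/-- Functions `ℂ → ℂ` that are meromorphic at every point (with arbitrary values at the poles). -/
def meroFun : Subalgebra ℂ (ℂ → ℂ) where
  carrier := {f | Meromorphic f}
  mul_mem' := fun {f g} (hf : Meromorphic f) (hg : Meromorphic g) => by
    intro z; exact (hf z).mul (hg z)
  add_mem' := fun {f g} (hf : Meromorphic f) (hg : Meromorphic g) => by
    intro z; exact (hf z).add (hg z)
  algebraMap_mem' := fun c z => MeromorphicAt.const c z

/-- Functions that vanish off a closed discrete subset of `ℂ`. -/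
def meroNull : Ideal meroFun where
  carrier := {f | ∀ᶠ z in Filter.codiscrete ℂ, (f : ℂ → ℂ) z = 0}
  add_mem' := by
    intro f g hf hg
    rw [Set.mem_ofPred_eq] at hf hg ⊢
    filter_upwards [hf, hg] with z h1 h2
    change (f : ℂ → ℂ) z + (g : ℂ → ℂ) z = 0
    rw [h1, h2, add_zero]
  zero_mem' := by
    rw [Set.mem_ofPred_eq]
    exact Filter.Eventually.of_forall fun _ => rfl
  smul_mem' := by
    intro f g hg
    rw [Set.mem_ofPred_eq] at hg ⊢
    filter_upwards [hg] with z h1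
    change (f : ℂ → ℂ) z * (g : ℂ → ℂ) z = 0
    rw [h1, mul_zero]

/-- The field `F` of meromorphic functions on `ℂ`: functions that are meromorphic at every point,
two of them being identified when they agree off a closed discrete set. -/
def Mero : Type := meroFun ⧸ meroNull

instance : CommRing Mero := inferInstanceAs (CommRing (meroFun ⧸ meroNull))
instance : Algebra ℂ Mero := inferInstanceAs (Algebra ℂ (meroFun ⧸ meroNull))

/-- The class in `F` of a meromorphic function. -/
def Mero.of (f : ℂ → ℂ) (hf : Meromorphic f) : Mero :=
  Ideal.Quotient.mk meroNull ⟨f, hf⟩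

/-- The algebra `K = F ⊗ F` of coefficients `f(λ, μ)`. -/
def Coef : Type := Mero ⊗[ℂ] Mero

instance : CommRing Coef := inferInstanceAs (CommRing (Mero ⊗[ℂ] Mero))
instance : Algebra ℂ Coef := inferInstanceAs (Algebra ℂ (Mero ⊗[ℂ] Mero))

/-- `f ↦ f(λ) = f ⊗ 1`. -/
def inLam : Mero →ₐ[ℂ] Coef :=
  (Algebra.TensorProduct.includeLeft : Mero →ₐ[ℂ] Mero ⊗[ℂ] Mero)

/-- `f ↦ f(μ) = 1 ⊗ f`. -/
def inMu : Mero →ₐ[ℂ] Coef :=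
  (Algebra.TensorProduct.includeRight : Mero →ₐ[ℂ] Mero ⊗[ℂ] Mero)

/-! ### Powers of `q` -/

/-- `q ^ s = exp (h s)`, where `q = exp h`. -/
def qpow (h s : ℂ) : ℂ := Complex.exp (h * s)

/-- The `q`-shifted factorial `(a; b)_n = ∏_{j < n} (1 - a b ^ j)`. -/
def qPoch (a b : ℂ) (n : ℕ) : ℂ := ∏ j ∈ Finset.range n, (1 - a * b ^ j)

/-! ### The algebra `U_q(sl₂)` -/

/-- Names for the generators. -/
inductive Gen
  | k | kinv | e | f

/-- The defining relations of `U_q(sl₂)`, with `q = exp h`. -/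
inductive Rel (h : ℂ) : FreeAlgebra ℂ Gen → FreeAlgebra ℂ Gen → Prop
  | k_kinv : Rel h (FreeAlgebra.ι ℂ Gen.k * FreeAlgebra.ι ℂ Gen.kinv) 1
  | kinv_k : Rel h (FreeAlgebra.ι ℂ Gen.kinv * FreeAlgebra.ι ℂ Gen.k) 1
  | k_e : Rel h (FreeAlgebra.ι ℂ Gen.k * FreeAlgebra.ι ℂ Gen.e)
      (qpow h 1 • (FreeAlgebra.ι ℂ Gen.e * FreeAlgebra.ι ℂ Gen.k))
  | k_f : Rel h (FreeAlgebra.ι ℂ Gen.k * FreeAlgebra.ι ℂ Gen.f)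
      (qpow h (-1) • (FreeAlgebra.ι ℂ Gen.f * FreeAlgebra.ι ℂ Gen.k))
  | e_f : Rel h (FreeAlgebra.ι ℂ Gen.e * FreeAlgebra.ι ℂ Gen.f
        - FreeAlgebra.ι ℂ Gen.f * FreeAlgebra.ι ℂ Gen.e)
      ((qpow h 1 - qpow h (-1))⁻¹ •
        (FreeAlgebra.ι ℂ Gen.k ^ 2 - FreeAlgebra.ι ℂ Gen.kinv ^ 2))

/-- The quantized universal enveloping algebra `U = U_q(sl₂)`. -/
def Uq (h : ℂ) : Type := RingQuot (Rel h)

instance (h : ℂ) : Ring (Uq h) := inferInstanceAs (Ring (RingQuot (Rel h)))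
instance (h : ℂ) : Algebra ℂ (Uq h) := inferInstanceAs (Algebra ℂ (RingQuot (Rel h)))

/-- The quotient map from the free algebra. -/
def Uq.mk (h : ℂ) : FreeAlgebra ℂ Gen →ₐ[ℂ] Uq h := RingQuot.mkAlgHom ℂ (Rel h)

lemma Uq.mk_rel (h : ℂ) {a b : FreeAlgebra ℂ Gen} (r : Rel h a b) : Uq.mk h a = Uq.mk h b :=
  RingQuot.mkAlgHom_rel ℂ r

/-- The image in `U` of a generator. -/
def gen (h : ℂ) (g : Gen) : Uq h := Uq.mk h (FreeAlgebra.ι ℂ g)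

def uk (h : ℂ) : Uq h := gen h Gen.k
def ukinv (h : ℂ) : Uq h := gen h Gen.kinv
def ue (h : ℂ) : Uq h := gen h Gen.e
def uf (h : ℂ) : Uq h := gen h Gen.f

lemma uk_mul_ukinv (h : ℂ) : uk h * ukinv h = 1 := by
  simpa [uk, ukinv, gen] using Uq.mk_rel h Rel.k_kinv

lemma ukinv_mul_uk (h : ℂ) : ukinv h * uk h = 1 := by
  simpa [uk, ukinv, gen] using Uq.mk_rel h Rel.kinv_k

lemma uk_mul_ue (h : ℂ) : uk h * ue h = qpow h 1 • (ue h * uk h) := by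
  simpa [uk, ue, gen] using Uq.mk_rel h Rel.k_e

lemma uk_mul_uf (h : ℂ) : uk h * uf h = qpow h (-1) • (uf h * uk h) := by
  simpa [uk, uf, gen] using Uq.mk_rel h Rel.k_f

/-- `k` as a unit of `U`, so that `T = {k ^ m | m ∈ ℤ}`. -/
def ukUnit (h : ℂ) : (Uq h)ˣ := ⟨uk h, ukinv h, uk_mul_ukinv h, ukinv_mul_uk h⟩

/-! ### The quantized function algebra and its regular bimodule structure -/

/-- A finite dimensional representation of `U` is of type 1 if `k` is diagonalizable
with eigenvalues in `{q ^ (r / 2) | r ∈ ℤ}`. -/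
def IsType1 (h : ℂ) {n : ℕ} (ρ : Uq h →ₐ[ℂ] Module.End ℂ (Fin n → ℂ)) : Prop :=
  ⨆ r : ℤ, (ρ (uk h)).eigenspace (qpow h ((r : ℂ) / 2)) = ⊤

/-- `a ∈ U*` is a matrix coefficient of a finite dimensional type 1 representation. -/
def IsMatCoef (h : ℂ) (a : Module.Dual ℂ (Uq h)) : Prop :=
  ∃ (n : ℕ) (ρ : Uq h →ₐ[ℂ] Module.End ℂ (Fin n → ℂ)), IsType1 h ρ ∧
    ∃ (v : Fin n → ℂ) (ξ : Module.Dual ℂ (Fin n → ℂ)), ∀ u, a u = ξ (ρ u v)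

/-- The quantized function algebra `A = A_q[SL(2)]`: the subspace of `U*` spanned by the matrix
coefficients of the finite dimensional type 1 representations. -/
def Aq (h : ℂ) : Submodule ℂ (Module.Dual ℂ (Uq h)) :=
  Submodule.span ℂ {a | IsMatCoef h a}

/-- The left regular action on `U*`: `(u · a)(v) = a (v u)`. -/
def dualLeft (h : ℂ) (u : Uq h) : Module.Dual ℂ (Uq h) →ₗ[ℂ] Module.Dual ℂ (Uq h) :=
  Module.Dual.transpose (R := ℂ) (LinearMap.mulRight ℂ u)

/-- The right regular action on `U*`: `(a · u)(v) = a (u v)`. -/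
def dualRight (h : ℂ) (u : Uq h) : Module.Dual ℂ (Uq h) →ₗ[ℂ] Module.Dual ℂ (Uq h) :=
  Module.Dual.transpose (R := ℂ) (LinearMap.mulLeft ℂ u)

lemma dualLeft_apply (h : ℂ) (u : Uq h) (a : Module.Dual ℂ (Uq h)) (v : Uq h) :
    dualLeft h u a v = a (v * u) := rfl

lemma dualRight_apply (h : ℂ) (u : Uq h) (a : Module.Dual ℂ (Uq h)) (v : Uq h) :
    dualRight h u a v = a (u * v) := rfl

lemma dualLeft_mem (h : ℂ) (u : Uq h) : ∀ a ∈ Aq h, dualLeft h u a ∈ Aq h := by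
  intro a ha
  have : Aq h ≤ (Aq h).comap (dualLeft h u) := by
    refine Submodule.span_le.2 ?_
    rintro b ⟨n, ρ, hρ, v, ξ, hb⟩
    refine Submodule.subset_span ⟨n, ρ, hρ, ρ u v, ξ, fun w => ?_⟩
    rw [dualLeft_apply, hb, map_mul]; rfl
  exact this ha

lemma dualRight_mem (h : ℂ) (u : Uq h) : ∀ a ∈ Aq h, dualRight h u a ∈ Aq h := by
  intro a ha
  have : Aq h ≤ (Aq h).comap (dualRight h u) := by
    refine Submodule.span_le.2 ?_
    rintro b ⟨n, ρ, hρ, v, ξ, hb⟩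
    refine Submodule.subset_span ⟨n, ρ, hρ, v, ξ ∘ₗ ρ u, fun w => ?_⟩
    rw [dualRight_apply, hb, map_mul]; rfl
  exact this ha

/-- The left regular action of `U` on `A`: `(u · a)(v) = a (v u)`. -/
def regLeft (h : ℂ) : Uq h →ₗ[ℂ] Module.End ℂ (Aq h) where
  toFun u := (dualLeft h u).restrict (dualLeft_mem h u)
  map_add' u u' := by
    ext a v
    change (a : Module.Dual ℂ (Uq h)) (v * (u + u')) = (a : Module.Dual ℂ (Uq h)) (v * u)
      + (a : Module.Dual ℂ (Uq h)) (v * u')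
    rw [mul_add, map_add]
  map_smul' c u := by
    ext a v
    change (a : Module.Dual ℂ (Uq h)) (v * (c • u)) = c • (a : Module.Dual ℂ (Uq h)) (v * u)
    rw [mul_smul_comm, map_smul]

/-- The right regular action of `U` on `A`: `(a · u)(v) = a (u v)`. -/
def regRight (h : ℂ) : Uq h →ₗ[ℂ] Module.End ℂ (Aq h) where
  toFun u := (dualRight h u).restrict (dualRight_mem h u)
  map_add' u u' := by
    ext a v
    change (a : Module.Dual ℂ (Uq h)) ((u + u') * v) = (a : Module.Dual ℂ (Uq h)) (u * v)
      + (a : Module.Dual ℂ (Uq h)) (u' * v)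
    rw [add_mul, map_add]
  map_smul' c u := by
    ext a v
    change (a : Module.Dual ℂ (Uq h)) ((c • u) * v) = c • (a : Module.Dual ℂ (Uq h)) (u * v)
    rw [smul_mul_assoc, map_smul]

/-- `A[α, β]`: the `a ∈ A` with `t · a = t ^ β a` and `a · t = t ^ α a` for all
`t = k ^ m ∈ T`, where `(k ^ m) ^ α = q ^ (m α / 2)`. -/
def weightSpace (h : ℂ) (α β : ℤ) : Submodule ℂ (Aq h) :=
  ⨅ m : ℤ,
    (regLeft h ((ukUnit h ^ m : (Uq h)ˣ) : Uq h)).eigenspace (qpow h ((m : ℂ) * (β : ℂ) / 2)) ⊓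
    (regRight h ((ukUnit h ^ m : (Uq h)ˣ) : Uq h)).eigenspace (qpow h ((m : ℂ) * (α : ℂ) / 2))

/-- `A_K = K ⊗ A`. -/
abbrev AK (h : ℂ) : Type := Coef ⊗[ℂ] (Aq h)

/-- `U_F = F ⊗ U`, whose elements are written `u(λ)`. -/
abbrev UF (h : ℂ) : Type := Mero ⊗[ℂ] (Uq h)

/-- `U_K = K ⊗ U`. -/
abbrev UK (h : ℂ) : Type := Coef ⊗[ℂ] (Uq h)

/-- `u ↦ u(λ) ∈ U_K`. -/
def atLam (h : ℂ) : UF h →ₗ[ℂ] UK h := TensorProduct.map inLam.toLinearMap LinearMap.id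

/-- `u ↦ u(μ) ∈ U_K`. -/
def atMu (h : ℂ) : UF h →ₗ[ℂ] UK h := TensorProduct.map inMu.toLinearMap LinearMap.id

/-- The `K`-linear extension of an action of `U` on `A` to one of `U_K` on `A_K`. -/
def extendAct (h : ℂ) (r : Uq h →ₗ[ℂ] Module.End ℂ (Aq h)) :
    UK h →ₗ[Coef] Module.End Coef (AK h) :=
  LinearMap.liftBaseChange Coef
    (LinearMap.baseChangeHom ℂ Coef (Aq h) (Aq h) ∘ₗ r)

lemma extendAct_tmul (h : ℂ) (r : Uq h →ₗ[ℂ] Module.End ℂ (Aq h)) (c c' : Coef) (u : Uq h)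
    (a : Aq h) : extendAct h r (c ⊗ₜ u) (c' ⊗ₜ a) = (c * c') ⊗ₜ (r u a) := rfl

/-- The left regular action of `U_K` on `A_K`: `actLeft h u a = u · a`. -/
def actLeft (h : ℂ) : UK h →ₗ[Coef] Module.End Coef (AK h) := extendAct h (regLeft h)

/-- The right regular action of `U_K` on `A_K`: `actRight h u a = a · u`. -/
def actRight (h : ℂ) : UK h →ₗ[Coef] Module.End Coef (AK h) := extendAct h (regRight h)

/-- `A_K[α, β] = K ⊗ A[α, β]`. -/
def weightSpaceK (h : ℂ) (α β : ℤ) : Submodule Coef (AK h) :=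
  (weightSpace h α β).baseChange Coef

/-! ### Locally finite sums of operators -/

/-- The sum of a family of operators of which only finitely many are nonzero on each vector. -/
def locSum {R M ι : Type*} [CommRing R] [AddCommGroup M] [Module R M]
    (S : ι → Module.End R M) (hS : ∀ z, {i | S i z ≠ 0}.Finite) : Module.End R M where
  toFun z := ∑ᶠ i, S i z
  map_add' z w := by
    simp only [map_add]
    exact finsum_add_distrib (hS z) (hS w)
  map_smul' c z := by
    simp only [map_smul, RingHom.id_apply]
    exact (smul_finsum' c (hS z)).symm

/-! ### The vertex-IRF transformation -/

/-- The function
`(-q^{-λ})^{l+m} / (q^{-2λ}; q²)_l · q^{l² - l + 2lm - 2m} (1 - q²)^{l+m} / ((q²; q²)_l (q²; q²)_m)`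
of `λ`. -/
def xCoefFun (h : ℂ) (l m : ℕ) (z : ℂ) : ℂ :=
  (-qpow h (-z)) ^ (l + m) / qPoch (qpow h (-2 * z)) (qpow h 2) l *
    (qpow h ((l : ℂ) ^ 2 - l + 2 * l * m - 2 * m) * (1 - qpow h 2) ^ (l + m) /
      (qPoch (qpow h 2) (qpow h 2) l * qPoch (qpow h 2) (qpow h 2) m))

lemma meromorphic_xCoefFun (h : ℂ) (l m : ℕ) : Meromorphic (xCoefFun h l m) := by
  intro z
  unfold xCoefFun
  refine MeromorphicAt.mul (MeromorphicAt.div ?_ ?_) (MeromorphicAt.const _ z)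
  · apply AnalyticAt.meromorphicAt
    unfold qpow
    fun_prop
  · apply AnalyticAt.meromorphicAt
    unfold qPoch qpow
    apply Finset.analyticAt_fun_prod
    intro j _
    fun_prop

/-- The term of index `(l, m)` of `x(λ)`: the above coefficient times
`(f k⁻¹)^l (e k⁻¹)^m`. -/
def xTerm (h : ℂ) (p : ℕ × ℕ) : UF h :=
  Mero.of (xCoefFun h p.1 p.2) (meromorphic_xCoefFun h p.1 p.2) ⊗ₜ
    ((uf h * ukinv h) ^ p.1 * (ue h * ukinv h) ^ p.2)

/-! Local nilpotency of `e` and `f`, which makes the sum defining `x(λ)` locally finite. -/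

lemma isNilpotent_of_qcomm {V : Type*} [AddCommGroup V] [Module ℂ V] [FiniteDimensional ℂ V]
    (P P' G : Module.End ℂ V) (hP : P' * P = 1) (c : ℂ) (hc0 : c ≠ 0)
    (hc : ∀ n : ℕ, 0 < n → c ^ n ≠ 1) (hPG : P * G = c • (G * P)) : IsNilpotent G := by
  have key : ∀ t : ℂ, G.HasEigenvalue t → t = 0 := by
    intro t ht
    by_contra ht0
    obtain ⟨v, hv⟩ := ht.exists_hasEigenvector
    have hPinj : ∀ w, P w = 0 → w = 0 := by
      intro w hw
      have : (P' * P) w = 0 := by rw [Module.End.mul_apply, hw, map_zero]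
      simpa [hP] using this
    have step : ∀ (s : ℂ) (w : V), G.HasEigenvector s w →
        G.HasEigenvector (c⁻¹ * s) (P w) := by
      intro s w hw
      refine ⟨Module.End.mem_eigenspace_iff.2 ?_, fun h0 => hw.2 (hPinj w h0)⟩
      have h1 : P (G w) = c • G (P w) := by
        simpa using congrArg (fun A : Module.End ℂ V => A w) hPG
      rw [hw.apply_eq_smul, map_smul] at h1
      rw [mul_smul, h1, smul_smul, inv_mul_cancel₀ hc0, one_smul]
    have all : ∀ n : ℕ, ∃ w, G.HasEigenvector (c⁻¹ ^ n * t) w := by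
      intro n
      induction n with
      | zero => exact ⟨v, by simpa using hv⟩
      | succ n ih =>
        obtain ⟨w, hw⟩ := ih
        refine ⟨P w, ?_⟩
        have := step _ _ hw
        rwa [← mul_assoc, ← pow_succ'] at this
    have hinj : Function.Injective fun n : ℕ => c⁻¹ ^ n * t := by
      intro a b hab
      have hab' : c⁻¹ ^ a = c⁻¹ ^ b := mul_right_cancel₀ ht0 hab
      rw [inv_pow, inv_pow, inv_inj] at hab'
      rcases lt_trichotomy a b with hlt | heq | hlt
      · exfalso
        refine hc (b - a) (by omega) (mul_left_cancel₀ (pow_ne_zero a hc0) ?_)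
        rw [← pow_add, mul_one, hab']; congr 1; omega
      · exact heq
      · exfalso
        refine hc (a - b) (by omega) (mul_left_cancel₀ (pow_ne_zero b hc0) ?_)
        rw [← pow_add, mul_one, ← hab']; congr 1; omega
    have hfin : (Set.range fun n : ℕ => c⁻¹ ^ n * t).Finite := by
      refine (Module.End.finite_spectrum G).subset ?_
      rintro _ ⟨n, rfl⟩
      obtain ⟨w, hw⟩ := all n
      exact (Module.End.hasEigenvalue_of_hasEigenvector hw).mem_spectrum
    exact Set.infinite_range_of_injective hinj hfin
  have htop : G.maxGenEigenspace 0 = ⊤ := by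
    rw [eq_top_iff, ← Module.End.iSup_maxGenEigenspace_eq_top G]
    refine iSup_le fun t => ?_
    by_cases ht : t = 0
    · rw [ht]
    · have hne : ¬ G.HasEigenvalue t := fun hh => ht (key t hh)
      intro w hw
      rw [Module.End.mem_maxGenEigenspace] at hw
      obtain ⟨n, hn⟩ := hw
      have hinj : Function.Injective (G - t • (1 : Module.End ℂ V)) := by
        rw [← LinearMap.ker_eq_bot, ← Module.End.eigenspace_def]
        rw [Module.End.hasEigenvalue_iff] at hne
        exact not_not.1 hne
      have hinj' : Function.Injective ((G - t • (1 : Module.End ℂ V)) ^ n) := by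
        rw [Module.End.coe_pow]
        exact hinj.iterate n
      have hw0 : w = 0 := hinj' (by rw [hn, map_zero])
      rw [hw0]
      exact Submodule.zero_mem _
  rw [Module.End.isNilpotent_iff_of_finite]
  intro m
  have hm : m ∈ G.maxGenEigenspace 0 := by rw [htop]; trivial
  rw [Module.End.mem_maxGenEigenspace] at hm
  simpa using hm

lemma qpow_one_ne (h : ℂ) (hq : ∀ n : ℕ, 0 < n → Complex.exp h ^ n ≠ 1) :
    (∀ n : ℕ, 0 < n → qpow h 1 ^ n ≠ 1) ∧ (∀ n : ℕ, 0 < n → qpow h (-1) ^ n ≠ 1) := by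
  constructor
  · intro n hn
    simpa [qpow] using hq n hn
  · intro n hn h1
    apply hq n hn
    have h2 : qpow h (-1) = (Complex.exp h)⁻¹ := by simp [qpow, Complex.exp_neg]
    rw [h2, inv_pow, inv_eq_one] at h1
    exact h1

lemma uk_mul_ueKinv (h : ℂ) :
    uk h * (ue h * ukinv h) = qpow h 1 • ((ue h * ukinv h) * uk h) := by
  rw [← mul_assoc, uk_mul_ue, mul_assoc (ue h), ukinv_mul_uk, mul_one, smul_mul_assoc,
    mul_assoc, uk_mul_ukinv, mul_one]

lemma uk_mul_ufKinv (h : ℂ) :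
    uk h * (uf h * ukinv h) = qpow h (-1) • ((uf h * ukinv h) * uk h) := by
  rw [← mul_assoc, uk_mul_uf, mul_assoc (uf h), ukinv_mul_uk, mul_one, smul_mul_assoc,
    mul_assoc, uk_mul_ukinv, mul_one]

/-- The monomial `(f k⁻¹)^l (e k⁻¹)^m` is eventually killed by each element of `A`. -/
lemma mono_eventually_zero (h : ℂ) (hq : ∀ n : ℕ, 0 < n → Complex.exp h ^ n ≠ 1)
    (a : Module.Dual ℂ (Uq h)) (ha : a ∈ Aq h) :
    ∃ N : ℕ, ∀ l m : ℕ, N ≤ l ∨ N ≤ m → ∀ u v : Uq h,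
      a (u * ((uf h * ukinv h) ^ l * (ue h * ukinv h) ^ m) * v) = 0 := by
  induction ha using Submodule.span_induction with
  | mem a ha =>
    obtain ⟨n, ρ, -, v₀, ξ, hb⟩ := ha
    have hkk : ρ (ukinv h) * ρ (uk h) = 1 := by rw [← map_mul, ukinv_mul_uk, map_one]
    obtain ⟨N₁, hN₁⟩ := isNilpotent_of_qcomm (ρ (uk h)) (ρ (ukinv h)) (ρ (ue h * ukinv h)) hkk
      (qpow h 1) (Complex.exp_ne_zero _) (qpow_one_ne h hq).1
      (by rw [← map_mul, uk_mul_ueKinv, map_smul, map_mul ρ _ (uk h)])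
    obtain ⟨N₂, hN₂⟩ := isNilpotent_of_qcomm (ρ (uk h)) (ρ (ukinv h)) (ρ (uf h * ukinv h)) hkk
      (qpow h (-1)) (Complex.exp_ne_zero _) (qpow_one_ne h hq).2
      (by rw [← map_mul, uk_mul_ufKinv, map_smul, map_mul ρ _ (uk h)])
    refine ⟨max N₁ N₂, fun l m hlm u v => ?_⟩
    rw [hb, map_mul, map_mul, map_mul, map_pow, map_pow]
    rcases hlm with hl | hm
    · rw [pow_eq_zero_of_le ((le_max_right _ _).trans hl) hN₂]; simp
    · rw [pow_eq_zero_of_le ((le_max_left _ _).trans hm) hN₁]; simp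
  | zero => exact ⟨0, fun _ _ _ _ _ => rfl⟩
  | add a b _ _ iha ihb =>
    obtain ⟨N₁, h₁⟩ := iha
    obtain ⟨N₂, h₂⟩ := ihb
    refine ⟨max N₁ N₂, fun l m hlm u v => ?_⟩
    rw [LinearMap.add_apply, h₁ l m (by omega), h₂ l m (by omega), add_zero]
  | smul c a _ iha =>
    obtain ⟨N, hN⟩ := iha
    refine ⟨N, fun l m hlm u v => ?_⟩
    rw [LinearMap.smul_apply, hN l m hlm, smul_zero]

/-- Only finitely many terms of `x` act nontrivially on a given element of `A_K`. -/
lemma xTerm_finite (h : ℂ) (r : Uq h →ₗ[ℂ] Module.End ℂ (Aq h))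
    (hr : ∀ a : Aq h, ∃ N : ℕ, ∀ l m : ℕ, N ≤ l ∨ N ≤ m →
      r ((uf h * ukinv h) ^ l * (ue h * ukinv h) ^ m) a = 0)
    (c : ℕ × ℕ → Coef) (z : AK h) :
    {p : ℕ × ℕ | extendAct h r
      (c p ⊗ₜ ((uf h * ukinv h) ^ p.1 * (ue h * ukinv h) ^ p.2)) z ≠ 0}.Finite := by
  induction z using TensorProduct.induction_on with
  | zero => simp
  | tmul c' a =>
    obtain ⟨N, hN⟩ := hr a
    refine ((Set.finite_Iio N).prod (Set.finite_Iio N)).subset ?_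
    intro p hp
    by_contra hp'
    apply hp
    rw [extendAct_tmul, hN p.1 p.2 ?_, TensorProduct.tmul_zero]
    rw [Set.mem_prod, Set.mem_Iio, Set.mem_Iio] at hp'
    omega
  | add z w hz hw =>
    refine (hz.union hw).subset ?_
    intro p hp
    by_contra hp'
    rw [Set.mem_union, not_or, Set.mem_ofPred_eq, Set.mem_ofPred_eq, not_not, not_not] at hp'
    apply hp
    rw [map_add, hp'.1, hp'.2, add_zero]

lemma xLeft_finite (h : ℂ) (hq : ∀ n : ℕ, 0 < n → Complex.exp h ^ n ≠ 1) (z : AK h) :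
    {p : ℕ × ℕ | actLeft h (atMu h (xTerm h p)) z ≠ 0}.Finite := by
  refine xTerm_finite h (regLeft h) (fun a => ?_) (fun p => inMu
    (Mero.of (xCoefFun h p.1 p.2) (meromorphic_xCoefFun h p.1 p.2))) z
  obtain ⟨N, hN⟩ := mono_eventually_zero h hq a a.2
  refine ⟨N, fun l m hlm => Subtype.ext (LinearMap.ext fun v => ?_)⟩
  have := hN l m hlm v 1
  rw [mul_one] at this
  exact this

lemma xRight_finite (h : ℂ) (hq : ∀ n : ℕ, 0 < n → Complex.exp h ^ n ≠ 1) (z : AK h) :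
    {p : ℕ × ℕ | actRight h (atLam h (xTerm h p)) z ≠ 0}.Finite := by
  refine xTerm_finite h (regRight h) (fun a => ?_) (fun p => inLam
    (Mero.of (xCoefFun h p.1 p.2) (meromorphic_xCoefFun h p.1 p.2))) z
  obtain ⟨N, hN⟩ := mono_eventually_zero h hq a a.2
  refine ⟨N, fun l m hlm => Subtype.ext (LinearMap.ext fun v => ?_)⟩
  have := hN l m hlm 1 v
  rw [one_mul] at this
  exact this

/-- The operator `a ↦ x(μ) · a` on `A_K`. -/
def xLeft (h : ℂ) (hq : ∀ n : ℕ, 0 < n → Complex.exp h ^ n ≠ 1) : Module.End Coef (AK h) :=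
  locSum (fun p => actLeft h (atMu h (xTerm h p))) (xLeft_finite h hq)

/-- The operator `a ↦ a · x(λ)` on `A_K`. -/
def xRight (h : ℂ) (hq : ∀ n : ℕ, 0 < n → Complex.exp h ^ n ≠ 1) : Module.End Coef (AK h) :=
  locSum (fun p => actRight h (atLam h (xTerm h p))) (xRight_finite h hq)

/-- `A^x_{αβ} = x⁻¹(μ) · A_K[α, β] · x(λ)`. -/
def bigradedPiece (h : ℂ) (hq : ∀ n : ℕ, 0 < n → Complex.exp h ^ n ≠ 1) (α β : ℤ) :
    Submodule Coef (AK h) :=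
  (weightSpaceK h α β).map (Ring.inverse (xLeft h hq) * xRight h hq)

/-! ### The twisted primitive element and its eigenvalues -/

/-- `(q^{-λ-1} + q^{λ+1}) / (q - q⁻¹)` as an element of `F`. -/
def yCoef (h : ℂ) : Mero :=
  Mero.of (fun z => (qpow h (-z - 1) + qpow h (z + 1)) / (qpow h 1 - qpow h (-1))) (by
    intro z
    apply AnalyticAt.meromorphicAt
    unfold qpow
    fun_prop)

/-- The twisted primitive element
`Y(λ) = f k - e k + (q^{-λ-1} + q^{λ+1}) / (q - q⁻¹) (k² - 1)`. -/
def Y (h : ℂ) : UF h :=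
  1 ⊗ₜ (uf h * uk h - ue h * uk h) + yCoef h ⊗ₜ (uk h ^ 2 - 1)

/-- `ν_α(λ) = (q^{-λ-1} (q^{-α} - 1) + q^{λ+1} (q^α - 1)) / (q - q⁻¹)` as an element of `F`. -/
def nu (h : ℂ) (α : ℤ) : Mero :=
  Mero.of (fun z => (qpow h (-z - 1) * (qpow h (-(α : ℂ)) - 1) +
      qpow h (z + 1) * (qpow h (α : ℂ) - 1)) / (qpow h 1 - qpow h (-1))) (by
    intro z
    apply AnalyticAt.meromorphicAt
    unfold qpow
    fun_prop)

end

end SL2Dyn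

namespace SL2Dyn

/-! Conjugation by x diagonalizes Y. Put t = q^{-λ}, E = e k⁻¹, F = f k⁻¹ and Z = z₋ (k⁻² - 1) + z₊
(k² - 1), where z₋ and z₊ are constant multiples of t and t⁻¹ with z₋ + z₊ equal to the coefficient
of k² - 1 in Y. Then x Y = Z x (`intertwine`): moving all powers of k to the right, one compares
coefficients of F^l E^m k^{±2} and F^l E^m, and the identities reduce to the two recurrences
satisfied by the coefficients of x, one in l and one in m.

Z acts on vectors of weight β by ν_β. Differences of distinct ν's are units of F because q is not a
root of unity, and A is the sum of its weight spaces, so A_K[α, β] is exactly the joint eigenspace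
of Z(μ) on the left and Z(λ) on the right (`mem_weightSpaceK_iff`). Left and right actions commute,
so the operator x⁻¹(μ) · ( ) · x(λ) carries this eigenspace onto that of Y
(`mem_bigradedPiece_iff`).

Invertibility of x is not read off from an explicit inverse. The coefficients of x are rational
functions of t, regular at t = 0, and at t = 0 the series collapses to 1. Every element of A lies in
a finite-dimensional subspace stable under the action, where x becomes a matrix over the local ring
of rational functions regular at 0 with determinant 1 at t = 0. That determinant is a unit there,
hence also in K (`isUnit_locSum`). This argument suits K = F ⊗ F, which is not a field. -/

/-! ### Computing in the field of meromorphic functions -/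

lemma Mero.of_eq_of {f g : ℂ → ℂ} (hf : Meromorphic f) (hg : Meromorphic g)
    (hfg : ∀ᶠ z in Filter.codiscrete ℂ, f z = g z) : Mero.of f hf = Mero.of g hg := by
  refine Ideal.Quotient.eq.2 ?_
  change ∀ᶠ z in Filter.codiscrete ℂ, f z - g z = 0
  filter_upwards [hfg] with z hz
  rw [hz, sub_self]

lemma Mero.of_mul_of {f g : ℂ → ℂ} (hf : Meromorphic f) (hg : Meromorphic g)
    (hfg : Meromorphic (fun z => f z * g z)) :
    Mero.of f hf * Mero.of g hg = Mero.of (fun z => f z * g z) hfg := rfl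

lemma Mero.of_add_of {f g : ℂ → ℂ} (hf : Meromorphic f) (hg : Meromorphic g)
    (hfg : Meromorphic (fun z => f z + g z)) :
    Mero.of f hf + Mero.of g hg = Mero.of (fun z => f z + g z) hfg := rfl

lemma Mero.smul_of (c : ℂ) {f : ℂ → ℂ} (hf : Meromorphic f)
    (hcf : Meromorphic (fun z => c * f z)) :
    c • Mero.of f hf = Mero.of (fun z => c * f z) hcf := rfl

lemma Mero.of_one (h1 : Meromorphic (fun _ : ℂ => (1 : ℂ))) : Mero.of (fun _ => 1) h1 = 1 := rfl

/-- An entire function that is not identically zero is nonzero off a discrete set. -/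
lemma eventually_codiscrete_ne_zero {f : ℂ → ℂ} (hf : AnalyticOnNhd ℂ f Set.univ) {z₀ : ℂ}
    (hz₀ : f z₀ ≠ 0) : ∀ᶠ z in Filter.codiscrete ℂ, f z ≠ 0 := by
  have := hf.preimage_zero_mem_codiscrete (x := z₀) hz₀
  filter_upwards [this] with z hz
  simpa using hz

/-- The value Lean assigns to f / g at a zero of g is harmless: g is entire and not identically
zero, so its zeros form a closed discrete set, which F does not see. -/
lemma Mero.of_div_mul {f g : ℂ → ℂ} (hf : Meromorphic f) (hg : AnalyticOnNhd ℂ g Set.univ)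
    {z₀ : ℂ} (hz₀ : g z₀ ≠ 0) (hfg : Meromorphic (fun z => f z / g z)) (hg' : Meromorphic g) :
    Mero.of (fun z => f z / g z) hfg * Mero.of g hg' = Mero.of f hf := by
  rw [Mero.of_mul_of _ _ (fun z => (hfg z).mul (hg' z))]
  refine Mero.of_eq_of _ _ ?_
  filter_upwards [eventually_codiscrete_ne_zero hg hz₀] with z hz
  field_simp

lemma qpow_add (h a b : ℂ) : qpow h (a + b) = qpow h a * qpow h b := by
  rw [qpow, mul_add, Complex.exp_add]; rfl

lemma qpow_zero (h : ℂ) : qpow h 0 = 1 := by simp [qpow]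

lemma qpow_ne_zero (h a : ℂ) : qpow h a ≠ 0 := Complex.exp_ne_zero _

lemma analyticAt_qpow_neg (h z : ℂ) : AnalyticAt ℂ (fun z => qpow h (-z)) z := by
  unfold qpow; fun_prop

lemma meromorphic_qpow_neg (h : ℂ) : Meromorphic fun z => qpow h (-z) :=
  fun z => (analyticAt_qpow_neg h z).meromorphicAt

lemma analyticAt_qpow (h z : ℂ) : AnalyticAt ℂ (fun z => qpow h z) z := by
  unfold qpow; fun_prop

lemma meromorphic_qpow (h : ℂ) : Meromorphic fun z => qpow h z :=
  fun z => (analyticAt_qpow h z).meromorphicAt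

noncomputable section

/-- The function `q ^ (-λ)`. -/
def tM (h : ℂ) : Mero := Mero.of (fun z => qpow h (-z)) (meromorphic_qpow_neg h)

/-- The function `q ^ λ`. -/
def tInv (h : ℂ) : Mero := Mero.of (fun z => qpow h z) (meromorphic_qpow h)

lemma tM_mul_tInv (h : ℂ) : tM h * tInv h = 1 := by
  rw [← Mero.of_one (fun z => MeromorphicAt.const 1 z), tM, tInv,
    Mero.of_mul_of _ _ (fun z => (meromorphic_qpow_neg h z).mul (meromorphic_qpow h z))]
  congr 1
  funext z
  rw [← qpow_add, neg_add_cancel, qpow_zero]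

/-! ### Polynomials in t = q^{-λ} -/

lemma analyticOnNhd_eval_qpow (h : ℂ) (d : Polynomial ℂ) :
    AnalyticOnNhd ℂ (fun z => d.eval (qpow h (-z))) Set.univ := by
  intro z _
  have := (analyticAt_qpow_neg h z).aeval_polynomial d
  simpa [Polynomial.coe_aeval_eq_eval] using this

lemma meromorphic_eval_qpow (h : ℂ) (d : Polynomial ℂ) :
    Meromorphic fun z => d.eval (qpow h (-z)) :=
  fun z => (analyticOnNhd_eval_qpow h d z trivial).meromorphicAt

lemma aeval_tM (h : ℂ) (d : Polynomial ℂ) :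
    Polynomial.aeval (tM h) d =
      Mero.of (fun z => d.eval (qpow h (-z))) (meromorphic_eval_qpow h d) := by
  let t : meroFun := ⟨fun z => qpow h (-z), meromorphic_qpow_neg h⟩
  have h1 : Polynomial.aeval (tM h) d =
      Ideal.Quotient.mkₐ ℂ meroNull (Polynomial.aeval t d) :=
    Polynomial.aeval_algHom_apply (Ideal.Quotient.mkₐ ℂ meroNull) t d
  rw [h1]
  have h2 : Polynomial.aeval t d = ⟨fun z => d.eval (qpow h (-z)), meromorphic_eval_qpow h d⟩ := by
    apply Subtype.ext
    funext z
    have := Polynomial.aeval_algHom_apply ((Pi.evalAlgHom ℂ (fun _ : ℂ => ℂ) z).comp meroFun.val) t d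
    change ((Pi.evalAlgHom ℂ (fun _ : ℂ => ℂ) z).comp meroFun.val) (Polynomial.aeval t d) = _
    rw [← this, Polynomial.coe_aeval_eq_eval]
    rfl
  rw [h2]
  rfl

lemma exists_eval_qpow_ne_zero {h : ℂ} (h0 : h ≠ 0) {d : Polynomial ℂ} (hd : d ≠ 0) :
    ∃ z, d.eval (qpow h (-z)) ≠ 0 := by
  -- The extra factor X forces w ≠ 0, so that w is a value of the exponential and hence of q^{-z}.
  obtain ⟨w, hw⟩ := Polynomial.exists_eval_ne_zero_of_natDegree_lt_card (d * Polynomial.X)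
    (mul_ne_zero hd Polynomial.X_ne_zero)
    ((Cardinal.natCast_lt_aleph0).trans_le (Cardinal.aleph0_le_mk ℂ))
  rw [Polynomial.eval_mul, Polynomial.eval_X] at hw
  refine ⟨-(Complex.log w / h), ?_⟩
  rw [qpow, neg_neg, mul_div_cancel₀ _ h0, Complex.exp_log (right_ne_zero_of_mul hw)]
  exact left_ne_zero_of_mul hw

/-- The main source of units: as h ≠ 0, the function q^{-λ} takes every nonzero value, so a nonzero
polynomial in it is an entire function that is not identically zero. -/
lemma isUnit_aeval_tM {h : ℂ} (h0 : h ≠ 0) {d : Polynomial ℂ} (hd : d ≠ 0) :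
    IsUnit (Polynomial.aeval (tM h) d) := by
  obtain ⟨z₀, hz₀⟩ := exists_eval_qpow_ne_zero h0 hd
  have hm : Meromorphic fun z => 1 / d.eval (qpow h (-z)) :=
    fun z => (MeromorphicAt.const 1 z).div (meromorphic_eval_qpow h d z)
  refine IsUnit.of_mul_eq_one (Mero.of _ hm) ?_
  rw [aeval_tM, mul_comm]
  exact Mero.of_div_mul (fun z => MeromorphicAt.const 1 z) (analyticOnNhd_eval_qpow h d) hz₀ _ _

/-! ### The local ring of rational functions regular at t = 0 -/

/-- Polynomials that do not vanish at the origin. -/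
def nonvanishing : Submonoid (Polynomial ℂ) :=
  (nonZeroDivisors ℂ).comap (Polynomial.evalRingHom (0 : ℂ))

lemma mem_nonvanishing {d : Polynomial ℂ} : d ∈ nonvanishing ↔ d.eval 0 ≠ 0 := by
  simp [nonvanishing]

/-- Rational functions that are regular at the origin. -/
abbrev RegRat : Type := Localization nonvanishing

/-- The value at the origin. -/
def regEval : RegRat →ₐ[ℂ] ℂ :=
  IsLocalization.liftAlgHom (M := nonvanishing) (f := Polynomial.aeval (0 : ℂ)) fun d => by
    rw [Polynomial.coe_aeval_eq_eval]
    exact (mem_nonvanishing.1 d.2).isUnit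

/-- Substitution of `q ^ (-λ)` for the variable. -/
def regSubst {h : ℂ} (h0 : h ≠ 0) : RegRat →ₐ[ℂ] Mero :=
  IsLocalization.liftAlgHom (M := nonvanishing) (f := Polynomial.aeval (tM h)) fun d =>
    isUnit_aeval_tM h0 fun hd => mem_nonvanishing.1 d.2 (by rw [hd, Polynomial.eval_zero])

lemma regEval_mk'_mul (n : Polynomial ℂ) (d : nonvanishing) :
    regEval (IsLocalization.mk' RegRat n d) * (d : Polynomial ℂ).eval 0 = n.eval 0 := by
  have h1 := congrArg regEval (IsLocalization.mk'_spec RegRat n d)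
  rw [map_mul] at h1
  simpa [regEval, IsLocalization.liftAlgHom_apply, Polynomial.coe_aeval_eq_eval] using h1

lemma regSubst_mk'_mul {h : ℂ} (h0 : h ≠ 0) (n : Polynomial ℂ) (d : nonvanishing) :
    regSubst h0 (IsLocalization.mk' RegRat n d) * Polynomial.aeval (tM h) (d : Polynomial ℂ)
      = Polynomial.aeval (tM h) n := by
  have h1 := congrArg (regSubst h0) (IsLocalization.mk'_spec RegRat n d)
  rw [map_mul] at h1
  simpa [regSubst, IsLocalization.liftAlgHom_apply] using h1

/-- A fraction n / d with nonzero value at 0 has n(0) ≠ 0, so n is itself an allowed denominator.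
Invertibility can thus be tested at t = 0. -/
instance : IsLocalHom regEval where
  map_nonunit r hr := by
    obtain ⟨n, d, rfl⟩ := IsLocalization.exists_mk'_eq nonvanishing r
    have h1 := regEval_mk'_mul n d
    have h2 : n.eval 0 ≠ 0 := by
      rw [← h1]
      exact mul_ne_zero hr.ne_zero (mem_nonvanishing.1 d.2)
    refine isUnit_of_mul_isUnit_left (y := algebraMap _ RegRat (d : Polynomial ℂ)) ?_
    rw [IsLocalization.mk'_spec]
    exact IsLocalization.map_units RegRat (⟨n, mem_nonvanishing.2 h2⟩ : nonvanishing)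

/-! ### The coefficients of x as rational functions of t -/

/-- The coefficient of `(f k⁻¹)^l (e k⁻¹)^m` in `x(λ)`. -/
def xCoef (h : ℂ) (l m : ℕ) : Mero := Mero.of (xCoefFun h l m) (meromorphic_xCoefFun h l m)

/-- The polynomial `(t²; q²)_l`. -/
def pochPoly (h : ℂ) (l : ℕ) : Polynomial ℂ :=
  ∏ j ∈ Finset.range l, (1 - Polynomial.X ^ 2 * Polynomial.C (qpow h 2 ^ j))

/-- The constant factor of the coefficient of `(f k⁻¹)^l (e k⁻¹)^m` in `x(λ)`. -/
def xConst (h : ℂ) (l m : ℕ) : ℂ :=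
  qpow h ((l : ℂ) ^ 2 - l + 2 * l * m - 2 * m) * (1 - qpow h 2) ^ (l + m) /
      (qPoch (qpow h 2) (qpow h 2) l * qPoch (qpow h 2) (qpow h 2) m)

lemma pochPoly_eval_zero (h : ℂ) (l : ℕ) : (pochPoly h l).eval 0 = 1 := by
  simp [pochPoly, Polynomial.eval_prod]

lemma pochPoly_eval (h : ℂ) (l : ℕ) (z : ℂ) :
    (pochPoly h l).eval (qpow h (-z)) = qPoch (qpow h (-2 * z)) (qpow h 2) l := by
  have : qpow h (-2 * z) = qpow h (-z) ^ 2 := by rw [sq, ← qpow_add]; ring_nf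
  rw [qPoch, this]
  simp [pochPoly, Polynomial.eval_prod]

lemma pochPoly_ne_zero (h : ℂ) (l : ℕ) : pochPoly h l ≠ 0 := by
  intro h0
  have := pochPoly_eval_zero h l
  simp [h0] at this

/-- The cleared-denominator form of the coefficient. The denominator is a unit of F, so identities
between coefficients may be checked on this form and the unit cancelled. -/
lemma xCoef_mul_pochPoly {h : ℂ} (h0 : h ≠ 0) (l m : ℕ) :
    xCoef h l m * Polynomial.aeval (tM h) (pochPoly h l) =
      xConst h l m • (-tM h) ^ (l + m) := by
  obtain ⟨z₀, hz₀⟩ := exists_eval_qpow_ne_zero h0 (pochPoly_ne_zero h l)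
  have hn : xConst h l m • (-tM h) ^ (l + m) =
      Polynomial.aeval (tM h) (Polynomial.C (xConst h l m) * (-Polynomial.X) ^ (l + m)) := by
    simp [Algebra.smul_def]
  rw [hn, aeval_tM, aeval_tM, xCoef]
  refine Eq.trans ?_ (Mero.of_div_mul (meromorphic_eval_qpow h _)
    (analyticOnNhd_eval_qpow h (pochPoly h l)) hz₀ (fun z => ((meromorphic_eval_qpow h _) z).div
      (meromorphic_eval_qpow h _ z)) (meromorphic_eval_qpow h _))
  congr 2
  funext z
  rw [pochPoly_eval, xCoefFun, xConst]
  simp only [Polynomial.eval_mul, Polynomial.eval_C, Polynomial.eval_pow, Polynomial.eval_neg,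
    Polynomial.eval_X]
  ring

/-- The coefficients of `x(λ)` as rational functions of `q ^ (-λ)`. -/
def xReg (h : ℂ) (p : ℕ × ℕ) : RegRat :=
  IsLocalization.mk' RegRat (Polynomial.C (xConst h p.1 p.2) * (-Polynomial.X) ^ (p.1 + p.2))
    (⟨pochPoly h p.1, mem_nonvanishing.2 (by rw [pochPoly_eval_zero]; exact one_ne_zero)⟩ :
      nonvanishing)

lemma regSubst_xReg {h : ℂ} (h0 : h ≠ 0) (p : ℕ × ℕ) :
    regSubst h0 (xReg h p) = xCoef h p.1 p.2 := by
  refine (isUnit_aeval_tM h0 (pochPoly_ne_zero h p.1)).mul_right_cancel ?_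
  rw [xCoef_mul_pochPoly h0]
  refine (regSubst_mk'_mul h0 _ _).trans ?_
  simp [Algebra.smul_def]

/-- The numerator carries t^{l+m} and the denominator is 1 at t = 0, so x degenerates to the
identity there. -/
lemma regEval_xReg (h : ℂ) (p : ℕ × ℕ) :
    regEval (xReg h p) = if p = (0, 0) then 1 else 0 := by
  have h1 := regEval_mk'_mul (Polynomial.C (xConst h p.1 p.2) * (-Polynomial.X) ^ (p.1 + p.2))
    (⟨pochPoly h p.1, mem_nonvanishing.2 (by rw [pochPoly_eval_zero]; exact one_ne_zero)⟩ :
      nonvanishing)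
  simp only [pochPoly_eval_zero, mul_one] at h1
  refine h1.trans ?_
  obtain ⟨l, m⟩ := p
  split_ifs with hp
  · rw [Prod.mk.injEq] at hp
    simp [hp.1, hp.2, xConst, qPoch, qpow_zero]
  · rw [Prod.mk.injEq] at hp
    have : l + m ≠ 0 := by omega
    rw [Polynomial.eval_mul, Polynomial.eval_pow, Polynomial.eval_neg, Polynomial.eval_X, neg_zero,
      zero_pow this, mul_zero]

end

/-! ### Invertibility of locally finite sums of operators -/

section LocSum

variable {R K A ι : Type*} [CommRing R] [Algebra ℂ R] [CommRing K] [Algebra ℂ K]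
  [AddCommGroup A] [Module ℂ A]

/-- A combination of operators whose coefficients reduce modulo a local homomorphism to those of
the identity is invertible. -/
lemma isUnit_sum_baseChange (ε : R →ₐ[ℂ] ℂ) [IsLocalHom ε] (θ : R →ₐ[ℂ] K)
    [FiniteDimensional ℂ A] (s : Finset ι) (T : ι → Module.End ℂ A) (g : ι → R)
    (hT : ∑ i ∈ s, ε (g i) • T i = 1) :
    IsUnit (∑ i ∈ s, θ (g i) • (T i).baseChange K : Module.End K (K ⊗[ℂ] A)) := by
  classical
  let b := Module.finBasis ℂ A
  let M : ι → Matrix _ _ ℂ := fun i => LinearMap.toMatrix b b (T i)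
  -- One matrix over R with two specializations: ε sends it to the identity matrix, θ sends it to
  -- the matrix of the operator over K.
  let X : Matrix _ _ R := ∑ i ∈ s, g i • (M i).map (algebraMap ℂ R)
  have hX : IsUnit X := by
    rw [Matrix.isUnit_iff_isUnit_det]
    -- Since ε is local, det X is a unit of R as soon as its image under ε is; that image is det 1.
    refine (isUnit_map_iff ε _).1 ?_
    have h1 : ε X.det = (ε.mapMatrix X).det := AlgHom.map_det ε X
    have h2 : ε.mapMatrix X = ∑ i ∈ s, ε (g i) • M i := by
      rw [map_sum]
      refine Finset.sum_congr rfl fun i _ => ?_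
      ext a c
      simp
    have h3 : ∑ i ∈ s, ε (g i) • M i = 1 := by
      have := congrArg (LinearMap.toMatrix b b) hT
      rw [map_sum] at this
      simpa [M, LinearMap.toMatrix_one] using this
    rw [h1, h2, h3, Matrix.det_one]
    exact isUnit_one
  have hX' : IsUnit (θ.mapMatrix X) := hX.map θ.mapMatrix
  have h4 : LinearMap.toMatrix (Algebra.TensorProduct.basis K b) (Algebra.TensorProduct.basis K b)
      (∑ i ∈ s, θ (g i) • (T i).baseChange K) = θ.mapMatrix X := by
    rw [map_sum, map_sum]
    refine Finset.sum_congr rfl fun i _ => ?_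
    rw [map_smul, LinearMap.toMatrix_baseChange]
    ext a c
    simp [M]
  have h5 : ∑ i ∈ s, θ (g i) • (T i).baseChange K =
      Matrix.toLinAlgEquiv (Algebra.TensorProduct.basis K b) (θ.mapMatrix X) := by
    rw [← h4]
    exact (Matrix.toLin_toMatrix _ _ _).symm
  rw [h5]
  exact hX'.map (Matrix.toLinAlgEquiv (Algebra.TensorProduct.basis K b))

/-- A tensor is a finite sum of pure tensors, and closure of P under sums of subspaces merges the
subspaces needed for these into one. In `isUnit_locSum`, P means finite-dimensional and stable under
all the T i. -/
lemma exists_finiteDimensional_range (P : Submodule ℂ A → Prop)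
    (hsup : ∀ W W', P W → P W' → P (W ⊔ W')) (hW : ∀ a, ∃ W, P W ∧ a ∈ W) (z : K ⊗[ℂ] A) :
    ∃ W, P W ∧ z ∈ LinearMap.range (W.subtype.baseChange K) := by
  have mono : ∀ W W' : Submodule ℂ A, W ≤ W' →
      LinearMap.range (W.subtype.baseChange K) ≤ LinearMap.range (W'.subtype.baseChange K) := by
    rintro W W' hle _ ⟨y, rfl⟩
    refine ⟨(Submodule.inclusion hle).baseChange K y, ?_⟩
    rw [← LinearMap.comp_apply, ← LinearMap.baseChange_comp]
    rfl
  induction z using TensorProduct.induction_on with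
  | zero =>
    obtain ⟨W, h1, -⟩ := hW 0
    exact ⟨W, h1, Submodule.zero_mem _⟩
  | tmul c a =>
    obtain ⟨W, h1, h2⟩ := hW a
    exact ⟨W, h1, c ⊗ₜ ⟨a, h2⟩, rfl⟩
  | add z w hz hw =>
    obtain ⟨W, h1, h2⟩ := hz
    obtain ⟨W', h1', h2'⟩ := hw
    exact ⟨W ⊔ W', hsup _ _ h1 h1', Submodule.add_mem _ (mono _ _ le_sup_left h2)
      (mono _ _ le_sup_right h2')⟩

lemma finite_setOf_exists_apply_ne_zero (T : ι → Module.End ℂ A)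
    (hfin : ∀ a, {i | T i a ≠ 0}.Finite) (W : Submodule ℂ A) [FiniteDimensional ℂ W] :
    {i | ∃ w ∈ W, T i w ≠ 0}.Finite := by
  let b := Module.finBasis ℂ W
  refine (Set.finite_iUnion fun j => hfin (b j : A)).subset ?_
  rintro i ⟨w, hw, hi⟩
  by_contra hcon
  apply hi
  have hz : T i ∘ₗ W.subtype = 0 := by
    refine b.ext fun j => ?_
    by_contra hj
    exact hcon (Set.mem_iUnion.2 ⟨j, hj⟩)
  exact LinearMap.congr_fun hz ⟨w, hw⟩

/-- On K ⊗ W, with W finite-dimensional and stable, the sum is finite and `isUnit_sum_baseChange`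
applies. Such K ⊗ W exhaust K ⊗ A, and the sum preserves each of them, so bijectivity on each gives
bijectivity on the whole. -/
theorem isUnit_locSum (ε : R →ₐ[ℂ] ℂ) [IsLocalHom ε] (θ : R →ₐ[ℂ] K)
    (T : ι → Module.End ℂ A) (g : ι → R) (i₀ : ι) (hT₀ : T i₀ = 1) (hg₀ : ε (g i₀) = 1)
    (hg : ∀ i, i ≠ i₀ → ε (g i) = 0) (hfin : ∀ a, {i | T i a ≠ 0}.Finite)
    (hW : ∀ a, ∃ W : Submodule ℂ A, (FiniteDimensional ℂ W ∧ ∀ i, ∀ w ∈ W, T i w ∈ W) ∧ a ∈ W)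
    (S : ι → Module.End K (K ⊗[ℂ] A)) (hS : ∀ z, {i | S i z ≠ 0}.Finite)
    (hST : ∀ i, S i = θ (g i) • (T i).baseChange K) : IsUnit (locSum S hS) := by
  classical
  have key : ∀ W : Submodule ℂ A, (FiniteDimensional ℂ W ∧ ∀ i, ∀ w ∈ W, T i w ∈ W) →
      ∃ X : Module.End K (K ⊗[ℂ] W), IsUnit X ∧
        ∀ y, locSum S hS (W.subtype.baseChange K y) = W.subtype.baseChange K (X y) := by
    rintro W ⟨hWf, hWT⟩
    -- The index i₀ is inserted by hand so that the identity term is present even when W = 0.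
    let s : Finset ι := insert i₀ (finite_setOf_exists_apply_ne_zero T hfin W).toFinset
    let TW : ι → Module.End ℂ W := fun i => (T i).restrict (hWT i)
    refine ⟨∑ i ∈ s, θ (g i) • (TW i).baseChange K, isUnit_sum_baseChange ε θ s TW g ?_, ?_⟩
    · rw [Finset.sum_eq_single_of_mem i₀ (Finset.mem_insert_self _ _), hg₀, one_smul]
      · ext w
        simp [TW, hT₀]
      · intro i _ hi
        rw [hg i hi, zero_smul]
    · intro y
      have h1 : ∀ i, S i (W.subtype.baseChange K y) =
          W.subtype.baseChange K ((θ (g i) • (TW i).baseChange K) y) := by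
        intro i
        rw [hST, LinearMap.smul_apply, LinearMap.smul_apply, map_smul]
        congr 1
        rw [← LinearMap.comp_apply, ← LinearMap.comp_apply, ← LinearMap.baseChange_comp,
          ← LinearMap.baseChange_comp]
        rfl
      have h2 : ∀ i, i ∉ s → S i (W.subtype.baseChange K y) = 0 := by
        intro i hi
        rw [hST, LinearMap.smul_apply, ← LinearMap.comp_apply, ← LinearMap.baseChange_comp]
        have : T i ∘ₗ W.subtype = 0 := by
          ext w
          by_contra hne
          exact hi (Finset.mem_insert_of_mem ((Set.Finite.mem_toFinset _).2 ⟨w, w.2, hne⟩))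
        rw [this, LinearMap.baseChange_zero, LinearMap.zero_apply, smul_zero]
      change ∑ᶠ i, S i (W.subtype.baseChange K y) = _
      rw [finsum_eq_sum_of_support_subset (s := s), LinearMap.sum_apply, map_sum]
      · exact Finset.sum_congr rfl fun i _ => h1 i
      · intro i hi
        by_contra hne
        exact hi (h2 i hne)
  have hrange := fun z => exists_finiteDimensional_range (K := K)
    (fun W : Submodule ℂ A => FiniteDimensional ℂ W ∧ ∀ i, ∀ w ∈ W, T i w ∈ W)
    (by
      rintro W W' ⟨h1, h2⟩ ⟨h1', h2'⟩
      refine ⟨Submodule.finiteDimensional_sup W W', fun i w hw => ?_⟩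
      have : W ⊔ W' ≤ (W ⊔ W').comap (T i) :=
        sup_le (fun v hv => Submodule.mem_sup_left (h2 i v hv))
          fun v hv => Submodule.mem_sup_right (h2' i v hv)
      exact this hw) hW z
  rw [Module.End.isUnit_iff]
  constructor
  · rw [injective_iff_map_eq_zero]
    intro z hz
    obtain ⟨W, hWP, y, rfl⟩ := hrange z
    obtain ⟨X, hX, hXy⟩ := key W hWP
    rw [hXy] at hz
    have hinj : Function.Injective (W.subtype.baseChange K) :=
      Module.Flat.lTensor_preserves_injective_linearMap W.subtype W.injective_subtype
    have h0 : X y = 0 := hinj (by rw [hz, map_zero])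
    rw [((Module.End.isUnit_iff X).1 hX).1 (h0.trans (map_zero X).symm), map_zero]
  · intro z
    obtain ⟨W, hWP, y, rfl⟩ := hrange z
    obtain ⟨X, hX, hXy⟩ := key W hWP
    obtain ⟨y', rfl⟩ := ((Module.End.isUnit_iff X).1 hX).2 y
    exact ⟨_, hXy y'⟩

end LocSum

/-! ### Powers of q and recurrences for the coefficients of x -/

noncomputable section

lemma ne_zero_of_not_root {h : ℂ} (hq : ∀ n : ℕ, 0 < n → Complex.exp h ^ n ≠ 1) : h ≠ 0 := by
  rintro rfl
  exact hq 1 one_pos (by simp)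

lemma qpow_natCast (h : ℂ) (n : ℕ) : qpow h n = qpow h 1 ^ n := by
  rw [qpow, qpow, ← Complex.exp_nat_mul]; ring_nf

lemma qpow_two (h : ℂ) : qpow h 2 = qpow h 1 ^ 2 := by exact_mod_cast qpow_natCast h 2

lemma qpow_neg (h s : ℂ) : qpow h (-s) = (qpow h s)⁻¹ := by
  rw [qpow, mul_neg, Complex.exp_neg]; rfl

lemma qpow_two_pow_ne_one {h : ℂ} (hq : ∀ n : ℕ, 0 < n → Complex.exp h ^ n ≠ 1) (n : ℕ)
    (hn : 0 < n) : qpow h 2 ^ n ≠ 1 := by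
  rw [qpow_two, ← pow_mul]
  exact (qpow_one_ne h hq).1 _ (by omega)

lemma qPoch_succ (a b : ℂ) (n : ℕ) : qPoch a b (n + 1) = qPoch a b n * (1 - a * b ^ n) :=
  Finset.prod_range_succ _ _

lemma one_sub_qpow_two_ne_zero {h : ℂ} (hq : ∀ n : ℕ, 0 < n → Complex.exp h ^ n ≠ 1) (n : ℕ) :
    1 - qpow h 2 * qpow h 2 ^ n ≠ 0 := by
  rw [← pow_succ']
  exact sub_ne_zero.2 (qpow_two_pow_ne_one hq _ n.succ_pos).symm

lemma qPoch_ne_zero {h : ℂ} (hq : ∀ n : ℕ, 0 < n → Complex.exp h ^ n ≠ 1) (n : ℕ) :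
    qPoch (qpow h 2) (qpow h 2) n ≠ 0 :=
  Finset.prod_ne_zero_iff.2 fun j _ => one_sub_qpow_two_ne_zero hq j

lemma xConst_succ_right {h : ℂ} (hq : ∀ n : ℕ, 0 < n → Complex.exp h ^ n ≠ 1) (l m : ℕ) :
    xConst h l (m + 1) * (1 - qpow h 2 ^ (m + 1)) * qpow h 2 =
      qpow h 2 ^ l * (1 - qpow h 2) * xConst h l m := by
  have h1 := qPoch_ne_zero hq l
  have h2 := qPoch_ne_zero hq m
  have h3 := one_sub_qpow_two_ne_zero hq m
  have h4 : qpow h ((l : ℂ) ^ 2 - l + 2 * l * ((m + 1 : ℕ) : ℂ) - 2 * ((m + 1 : ℕ) : ℂ)) *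
      qpow h 2 = qpow h 2 ^ l * qpow h ((l : ℂ) ^ 2 - l + 2 * l * m - 2 * m) := by
    have : qpow h 2 ^ l = qpow h (2 * l) := by
      rw [qpow_two, ← pow_mul, ← qpow_natCast]; push_cast; rfl
    rw [this, ← qpow_add, ← qpow_add]
    congr 1
    push_cast
    ring
  rw [xConst, xConst, qPoch_succ, pow_succ' _ m, ← add_assoc, pow_succ _ (l + m)]
  generalize qpow h ((l : ℂ) ^ 2 - l + 2 * l * ((m + 1 : ℕ) : ℂ) - 2 * ((m + 1 : ℕ) : ℂ)) = x at *
  generalize qpow h ((l : ℂ) ^ 2 - l + 2 * l * m - 2 * m) = y at *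
  generalize qPoch (qpow h 2) (qpow h 2) l = P at *
  generalize qPoch (qpow h 2) (qpow h 2) m = P' at *
  generalize qpow h 2 = r at *
  field_simp
  linear_combination (1 - r) ^ (l + m + 1) * h4

lemma xConst_succ_left {h : ℂ} (hq : ∀ n : ℕ, 0 < n → Complex.exp h ^ n ≠ 1) (l m : ℕ) :
    xConst h (l + 1) m * (1 - qpow h 2 ^ (l + 1)) =
      qpow h 2 ^ l * qpow h 2 ^ m * (1 - qpow h 2) * xConst h l m := by
  have h1 := qPoch_ne_zero hq l
  have h2 := qPoch_ne_zero hq m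
  have h3 := one_sub_qpow_two_ne_zero hq l
  have h4 : qpow h (((l + 1 : ℕ) : ℂ) ^ 2 - ((l + 1 : ℕ) : ℂ) + 2 * ((l + 1 : ℕ) : ℂ) * m - 2 * m) =
      qpow h 2 ^ l * qpow h 2 ^ m * qpow h ((l : ℂ) ^ 2 - l + 2 * l * m - 2 * m) := by
    have : ∀ n : ℕ, qpow h 2 ^ n = qpow h (2 * n) := by
      intro n
      rw [qpow_two, ← pow_mul, ← qpow_natCast]; push_cast; rfl
    rw [this, this, ← qpow_add, ← qpow_add]
    congr 1
    push_cast
    ring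
  rw [xConst, xConst, qPoch_succ, pow_succ' _ l, add_right_comm, pow_succ _ (l + m), h4]
  generalize qpow h ((l : ℂ) ^ 2 - l + 2 * l * m - 2 * m) = y at *
  generalize qPoch (qpow h 2) (qpow h 2) l = P at *
  generalize qPoch (qpow h 2) (qpow h 2) m = P' at *
  generalize qpow h 2 = r at *
  rw [mul_comm r] at h3
  field_simp

lemma xCoef_succ_right {h : ℂ} (hq : ∀ n : ℕ, 0 < n → Complex.exp h ^ n ≠ 1) (l m : ℕ) :
    ((1 - qpow h 2 ^ (m + 1)) * qpow h 2) • xCoef h l (m + 1) =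
      -((qpow h 2 ^ l * (1 - qpow h 2)) • (tM h * xCoef h l m)) := by
  have h0 := ne_zero_of_not_root hq
  refine (isUnit_aeval_tM h0 (pochPoly_ne_zero h l)).mul_right_cancel ?_
  rw [neg_mul, smul_mul_assoc, smul_mul_assoc, mul_assoc, xCoef_mul_pochPoly h0,
    xCoef_mul_pochPoly h0, smul_smul, mul_smul_comm, smul_smul, ← xConst_succ_right hq,
    mul_comm _ (xConst h l (m + 1)), ← mul_assoc, ← smul_neg]
  congr 1
  ring

/-- Passing from l to l + 1 adds the factor 1 - q^{2l} t² to the denominator; it is kept as a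
multiplier on the left, so that no division in F is needed. -/
lemma xCoef_succ_left {h : ℂ} (hq : ∀ n : ℕ, 0 < n → Complex.exp h ^ n ≠ 1) (l m : ℕ) :
    (1 - qpow h 2 ^ (l + 1)) • ((1 - qpow h 2 ^ l • tM h ^ 2) * xCoef h (l + 1) m) =
      -((qpow h 2 ^ l * qpow h 2 ^ m * (1 - qpow h 2)) • (tM h * xCoef h l m)) := by
  have h0 := ne_zero_of_not_root hq
  refine (isUnit_aeval_tM h0 (pochPoly_ne_zero h l)).mul_right_cancel ?_
  have h1 : Polynomial.aeval (tM h) (pochPoly h (l + 1)) =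
      Polynomial.aeval (tM h) (pochPoly h l) * (1 - qpow h 2 ^ l • tM h ^ 2) := by
    rw [pochPoly, Finset.prod_range_succ, map_mul]
    congr 1
    simp [Algebra.smul_def, mul_comm]
  have h2 := xCoef_mul_pochPoly h0 (l + 1) m
  rw [h1] at h2
  have h3 : (1 - qpow h 2 ^ l • tM h ^ 2) * xCoef h (l + 1) m *
      Polynomial.aeval (tM h) (pochPoly h l) = xConst h (l + 1) m • (-tM h) ^ (l + 1 + m) := by
    rw [← h2]; ring
  rw [neg_mul, smul_mul_assoc, h3, smul_mul_assoc, mul_assoc (tM h), xCoef_mul_pochPoly h0, smul_smul,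
    mul_smul_comm, smul_smul, ← xConst_succ_left hq, mul_comm _ (xConst h (l + 1) m), ← smul_neg]
  congr 1
  ring

/-! ### Commutation relations for E, F and k^{±2} -/

/-- `e k⁻¹`. -/
def uE (h : ℂ) : Uq h := ue h * ukinv h

/-- `f k⁻¹`. -/
def uF (h : ℂ) : Uq h := uf h * ukinv h

lemma ue_mul_uf (h : ℂ) : ue h * uf h =
    uf h * ue h + (qpow h 1 - qpow h (-1))⁻¹ • (uk h ^ 2 - ukinv h ^ 2) := by
  have : ue h * uf h - uf h * ue h = (qpow h 1 - qpow h (-1))⁻¹ • (uk h ^ 2 - ukinv h ^ 2) := by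
    simpa [uk, ukinv, ue, uf, gen] using Uq.mk_rel h Rel.e_f
  rw [← this]
  abel

lemma ukinv_mul_of_uk_mul {h c : ℂ} (hc : c ≠ 0) {x : Uq h} (hx : uk h * x = c • (x * uk h)) :
    ukinv h * x = c⁻¹ • (x * ukinv h) := by
  have h1 : ukinv h * (uk h * x) * ukinv h = c • (ukinv h * x) := by
    rw [hx, mul_smul_comm, smul_mul_assoc, mul_assoc, mul_assoc, uk_mul_ukinv, mul_one]
  rw [← mul_assoc, ukinv_mul_uk, one_mul] at h1
  rw [h1, smul_smul, inv_mul_cancel₀ hc, one_smul]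

lemma sq_mul_of_mul {h c : ℂ} {g x : Uq h} (hx : g * x = c • (x * g)) (n : ℕ) :
    g ^ 2 * x ^ n = (c ^ 2) ^ n • (x ^ n * g ^ 2) := by
  have h1 : g ^ 2 * x = c ^ 2 • (x * g ^ 2) := by
    rw [sq, mul_assoc, hx, mul_smul_comm, ← mul_assoc, hx, smul_mul_assoc, smul_smul, ← sq,
      mul_assoc]
  induction n with
  | zero => simp
  | succ n ih =>
    rw [pow_succ x, ← mul_assoc, ih, smul_mul_assoc, mul_assoc, h1, mul_smul_comm, smul_smul,
      ← pow_succ, mul_assoc]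

lemma uk_sq_mul_uE_pow (h : ℂ) (n : ℕ) :
    uk h ^ 2 * uE h ^ n = (qpow h 1 ^ 2) ^ n • (uE h ^ n * uk h ^ 2) :=
  sq_mul_of_mul (uk_mul_ueKinv h) n

lemma uk_sq_mul_uF_pow (h : ℂ) (n : ℕ) :
    uk h ^ 2 * uF h ^ n = (qpow h (-1) ^ 2) ^ n • (uF h ^ n * uk h ^ 2) :=
  sq_mul_of_mul (uk_mul_ufKinv h) n

lemma ukinv_sq_mul_uE_pow (h : ℂ) (n : ℕ) :
    ukinv h ^ 2 * uE h ^ n = ((qpow h 1)⁻¹ ^ 2) ^ n • (uE h ^ n * ukinv h ^ 2) :=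
  sq_mul_of_mul (ukinv_mul_of_uk_mul (qpow_ne_zero _ _) (uk_mul_ueKinv h)) n

lemma ukinv_sq_mul_uF_pow (h : ℂ) (n : ℕ) :
    ukinv h ^ 2 * uF h ^ n = ((qpow h (-1))⁻¹ ^ 2) ^ n • (uF h ^ n * ukinv h ^ 2) :=
  sq_mul_of_mul (ukinv_mul_of_uk_mul (qpow_ne_zero _ _) (uk_mul_ufKinv h)) n

lemma ukinv_mul_ue (h : ℂ) : ukinv h * ue h = (qpow h 1)⁻¹ • (ue h * ukinv h) :=
  ukinv_mul_of_uk_mul (qpow_ne_zero _ _) (uk_mul_ue h)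

lemma ukinv_mul_uf (h : ℂ) : ukinv h * uf h = qpow h 1 • (uf h * ukinv h) := by
  have := ukinv_mul_of_uk_mul (qpow_ne_zero _ _) (uk_mul_uf h)
  rwa [qpow_neg, inv_inv] at this

lemma ukinv_sq_mul_uk_sq (h : ℂ) : ukinv h ^ 2 * uk h ^ 2 = 1 := by
  rw [sq, sq, mul_assoc, ← mul_assoc (ukinv h) (uk h), ukinv_mul_uk, one_mul, ukinv_mul_uk]

lemma uk_sq_mul_ukinv_sq (h : ℂ) : uk h ^ 2 * ukinv h ^ 2 = 1 := by
  rw [sq, sq, mul_assoc, ← mul_assoc (uk h) (ukinv h), uk_mul_ukinv, one_mul, uk_mul_ukinv]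

lemma uE_mul_uF (h : ℂ) : uE h * uF h = (qpow h 1 ^ 2) • (uF h * uE h) +
    (qpow h 1 * (qpow h 1 - qpow h (-1))⁻¹) • (1 - ukinv h ^ 2 * ukinv h ^ 2) := by
  have h1 : uE h * uF h = qpow h 1 • (ue h * uf h * ukinv h ^ 2) := by
    rw [uE, uF, mul_assoc, ← mul_assoc (ukinv h), ukinv_mul_uf, smul_mul_assoc, mul_smul_comm,
      sq, mul_assoc, mul_assoc]
  have h2 : uF h * uE h = (qpow h 1)⁻¹ • (uf h * ue h * ukinv h ^ 2) := by
    rw [uE, uF, mul_assoc, ← mul_assoc (ukinv h), ukinv_mul_ue, smul_mul_assoc, mul_smul_comm,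
      sq, mul_assoc, mul_assoc]
  rw [h1, h2, ue_mul_uf, add_mul, smul_mul_assoc, sub_mul, uk_sq_mul_ukinv_sq, smul_add, smul_smul,
    smul_smul, sq (qpow h 1), mul_assoc (qpow h 1) (qpow h 1), mul_inv_cancel₀ (qpow_ne_zero _ _),
    mul_one]

/-- Iterating the relation E F = q² F E + q (q - q⁻¹)⁻¹ (1 - k⁻⁴). Moving k⁻⁴ past E^j costs q^{-4j}
while moving F costs q^{2j}, whence the two geometric sums, in q² and in q⁻². -/
lemma uE_pow_mul_uF (h : ℂ) (n : ℕ) : uE h ^ n * uF h = (qpow h 1 ^ 2) ^ n • (uF h * uE h ^ n) +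
    (qpow h 1 * (qpow h 1 - qpow h (-1))⁻¹) •
      ((∑ j ∈ Finset.range n, (qpow h 1 ^ 2) ^ j) • uE h ^ (n - 1) -
        (∑ j ∈ Finset.range n, ((qpow h 1)⁻¹ ^ 2) ^ j) •
          (uE h ^ (n - 1) * (ukinv h ^ 2 * ukinv h ^ 2))) := by
  induction n with
  | zero => simp
  | succ n ih =>
    -- For n = 0 the truncated exponent n - 1 is wrong, but its coefficient is an empty sum and
    -- vanishes.
    have hE : ∀ s : ℂ, s = 0 ∨ n ≠ 0 → ∀ y, s • (uE h * (uE h ^ (n - 1) * y)) =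
        s • (uE h ^ n * y) := by
      rintro s (rfl | hn) y
      · simp
      · rw [← mul_assoc, ← pow_succ', Nat.sub_add_cancel (Nat.pos_of_ne_zero hn)]
    have hs : ∀ c : ℂ, (∑ j ∈ Finset.range n, c ^ j) = 0 ∨ n ≠ 0 := by
      intro c
      rcases eq_or_ne n 0 with rfl | hn
      · simp
      · exact Or.inr hn
    have hkk : ukinv h ^ 2 * ukinv h ^ 2 * uE h ^ n =
        (((qpow h 1)⁻¹ ^ 2) ^ n * ((qpow h 1)⁻¹ ^ 2) ^ n) •
          (uE h ^ n * (ukinv h ^ 2 * ukinv h ^ 2)) := by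
      rw [mul_assoc, ukinv_sq_mul_uE_pow, mul_smul_comm, ← mul_assoc, ukinv_sq_mul_uE_pow,
        smul_mul_assoc, smul_smul, mul_assoc]
    rw [pow_succ' (uE h), mul_assoc, ih, mul_add, mul_smul_comm, ← mul_assoc (uE h) (uF h),
      uE_mul_uF, mul_smul_comm, mul_sub, mul_smul_comm, mul_smul_comm, hE _ (hs _),
      ← mul_one (uE h ^ (n - 1)), hE _ (hs _), mul_one, add_mul, smul_mul_assoc, smul_mul_assoc,
      sub_mul, one_mul, hkk, Finset.sum_range_succ, Finset.sum_range_succ, Nat.add_sub_cancel,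
      mul_assoc (uF h)]
    have hq : (qpow h 1 ^ 2) ^ n * ((qpow h 1)⁻¹ ^ 2) ^ n = 1 := by
      rw [← mul_pow, ← mul_pow, mul_inv_cancel₀ (qpow_ne_zero _ _), one_pow, one_pow]
    -- The new term q^{-2n} of the second sum appears as q^{2n} · q^{-4n}, from F passing E^n and
    -- from k⁻⁴ passing E^n.
    have hq' : ((qpow h 1)⁻¹ ^ 2) ^ n =
        (qpow h 1 ^ 2) ^ n * (((qpow h 1)⁻¹ ^ 2) ^ n * ((qpow h 1)⁻¹ ^ 2) ^ n) := by
      rw [← mul_assoc, hq, one_mul]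
    rw [add_smul _ (((qpow h 1)⁻¹ ^ 2) ^ n)]
    conv_rhs => rw [hq']
    module

end

/-! ### Reindexing double sums and comparing coefficients -/

section Sums

variable {K M : Type*} [CommRing K] [AddCommGroup M] [Module K M]

lemma sum_range_smul_succ (b : ℕ → K) (G : ℕ → M) (N : ℕ) (hG : G N = 0) :
    ∑ l ∈ Finset.range N, b l • G (l + 1) =
      ∑ l ∈ Finset.range N, (if l = 0 then 0 else b (l - 1)) • G l := by
  have h1 := Finset.sum_range_succ (fun l => (if l = 0 then 0 else b (l - 1)) • G l) N
  have h2 := Finset.sum_range_succ' (fun l => (if l = 0 then 0 else b (l - 1)) • G l) N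
  simp only [hG, smul_zero, add_zero, if_true, zero_smul, Nat.succ_ne_zero, if_false,
    Nat.add_sub_cancel] at h1 h2
  rw [← h1, h2]

lemma sum_range_smul_pred (b : ℕ → K) (G : ℕ → M) (N : ℕ) (hG : G (N - 1) = 0) (hb : b 0 = 0) :
    ∑ l ∈ Finset.range N, b l • G (l - 1) = ∑ l ∈ Finset.range N, b (l + 1) • G l := by
  have h1 := Finset.sum_range_succ (fun l => b l • G (l - 1)) N
  have h2 := Finset.sum_range_succ' (fun l => b l • G (l - 1)) N
  simp only [hG, smul_zero, add_zero, hb, zero_smul, Nat.add_sub_cancel] at h1 h2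
  rw [← h1, h2]

/-- Comparison of coefficients in the intertwining relation for the vertex-IRF transformation. -/
lemma sum_intertwine (c : ℕ → ℕ → K) (G₂ G₀ Gm : ℕ → ℕ → M) (N : ℕ)
    (h₂l : ∀ l m, N ≤ l + 1 → G₂ l m = 0) (h₂m : ∀ l m, N ≤ m + 1 → G₂ l m = 0)
    (hmm : ∀ l m, N ≤ m + 1 → Gm l m = 0)
    (b u v : ℕ → K) (hu : u 0 = 0) (hv : v 0 = 0) (C Dm Dp : K) (wm wp : ℕ → ℕ → K)
    (hC : C = Dm + Dp)
    (hv' : ∀ l m, -(c l (m + 1) * v (m + 1)) = c l m * (Dm * wm l m))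
    (hu' : ∀ l m, (if l = 0 then 0 else c (l - 1) m * b m) + c l (m + 1) * u (m + 1)
      - (if m = 0 then 0 else c l (m - 1)) + c l m * C = c l m * (Dp * wp l m)) :
    ∑ l ∈ Finset.range N, ∑ m ∈ Finset.range N, c l m •
        (b m • G₂ (l + 1) m + (u m • G₂ l (m - 1) - v m • Gm l (m - 1)) - G₂ l (m + 1)
          + C • (G₂ l m - G₀ l m)) =
      ∑ l ∈ Finset.range N, ∑ m ∈ Finset.range N, c l m •
        (Dm • (wm l m • Gm l m - G₀ l m) + Dp • (wp l m • G₂ l m - G₀ l m)) := by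
  -- Each shifted family is reindexed to sit on index (l, m). The cutoff hypotheses kill the terms
  -- at the upper boundary; lowering m needs vanishing already at N - 1, which is why they read N ≤
  -- l + 1 and N ≤ m + 1.
  have e1 : ∑ l ∈ Finset.range N, ∑ m ∈ Finset.range N, (c l m * b m) • G₂ (l + 1) m =
      ∑ l ∈ Finset.range N, ∑ m ∈ Finset.range N,
        (if l = 0 then 0 else c (l - 1) m * b m) • G₂ l m := by
    rw [Finset.sum_comm, Finset.sum_comm (s := Finset.range N)
      (f := fun l m => (if l = 0 then 0 else c (l - 1) m * b m) • G₂ l m)]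
    exact Finset.sum_congr rfl fun m _ =>
      sum_range_smul_succ (fun l => c l m * b m) (fun l => G₂ l m) N (h₂l N m (by omega))
  have e2 : ∑ l ∈ Finset.range N, ∑ m ∈ Finset.range N, (c l m * u m) • G₂ l (m - 1) =
      ∑ l ∈ Finset.range N, ∑ m ∈ Finset.range N, (c l (m + 1) * u (m + 1)) • G₂ l m :=
    Finset.sum_congr rfl fun l _ => sum_range_smul_pred (fun m => c l m * u m) (G₂ l) N
      (h₂m l _ (by omega)) (by rw [hu, mul_zero])
  have e3 : ∑ l ∈ Finset.range N, ∑ m ∈ Finset.range N, (c l m * v m) • Gm l (m - 1) =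
      ∑ l ∈ Finset.range N, ∑ m ∈ Finset.range N, (c l (m + 1) * v (m + 1)) • Gm l m :=
    Finset.sum_congr rfl fun l _ => sum_range_smul_pred (fun m => c l m * v m) (Gm l) N
      (hmm l _ (by omega)) (by rw [hv, mul_zero])
  have e4 : ∑ l ∈ Finset.range N, ∑ m ∈ Finset.range N, c l m • G₂ l (m + 1) =
      ∑ l ∈ Finset.range N, ∑ m ∈ Finset.range N,
        (if m = 0 then 0 else c l (m - 1)) • G₂ l m :=
    Finset.sum_congr rfl fun l _ => sum_range_smul_succ (c l) (G₂ l) N (h₂m l N (by omega))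
  have e5 : ∑ l ∈ Finset.range N, ∑ m ∈ Finset.range N, c l m •
        (b m • G₂ (l + 1) m + (u m • G₂ l (m - 1) - v m • Gm l (m - 1)) - G₂ l (m + 1)
          + C • (G₂ l m - G₀ l m)) =
      ∑ l ∈ Finset.range N, ∑ m ∈ Finset.range N, (c l m * b m) • G₂ (l + 1) m
      + ∑ l ∈ Finset.range N, ∑ m ∈ Finset.range N, (c l m * u m) • G₂ l (m - 1)
      - ∑ l ∈ Finset.range N, ∑ m ∈ Finset.range N, (c l m * v m) • Gm l (m - 1)
      - ∑ l ∈ Finset.range N, ∑ m ∈ Finset.range N, c l m • G₂ l (m + 1)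
      + ∑ l ∈ Finset.range N, ∑ m ∈ Finset.range N, (c l m * C) • (G₂ l m - G₀ l m) := by
    simp only [← Finset.sum_add_distrib, ← Finset.sum_sub_distrib]
    refine Finset.sum_congr rfl fun l _ => Finset.sum_congr rfl fun m _ => ?_
    module
  rw [e5, e1, e2, e3, e4]
  simp only [← Finset.sum_add_distrib, ← Finset.sum_sub_distrib]
  refine Finset.sum_congr rfl fun l _ => Finset.sum_congr rfl fun m _ => ?_
  have hG₂ := congrArg (fun s : K => s • G₂ l m) (hu' l m)
  have hGm := congrArg (fun s : K => s • Gm l m) (hv' l m)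
  simp only [add_smul, sub_smul, neg_smul] at hG₂ hGm
  trans (c l m * (Dp * wp l m)) • G₂ l m + (c l m * (Dm * wm l m)) • Gm l m
    - (c l m * (Dm + Dp)) • G₀ l m
  · rw [← hG₂, ← hGm, ← hC]
    module
  · module

end Sums

/-! ### Coefficient identities and the relation x Y = Z x -/

noncomputable section

lemma qpow_sub_ne_zero {h : ℂ} (hq : ∀ n : ℕ, 0 < n → Complex.exp h ^ n ≠ 1) :
    qpow h 1 - qpow h (-1) ≠ 0 := by
  intro h1
  have h2 := qpow_two_pow_ne_one hq 1 one_pos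
  rw [qpow_neg, sub_eq_zero] at h1
  apply h2
  rw [pow_one, qpow_two, sq]
  nth_rewrite 1 [h1]
  exact inv_mul_cancel₀ (qpow_ne_zero _ _)

lemma one_sub_qpow_sq_ne_zero {h : ℂ} (hq : ∀ n : ℕ, 0 < n → Complex.exp h ^ n ≠ 1) :
    1 - qpow h 2 ≠ 0 := by
  simpa using one_sub_qpow_two_ne_zero hq 0

lemma inv_qpow_sub_eq (h : ℂ) :
    (qpow h 1 - qpow h (-1))⁻¹ = -(qpow h 1 * (1 - qpow h 2)⁻¹) := by
  have h3 := qpow_ne_zero h 1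
  have h4 : qpow h 1 - qpow h (-1) = -((qpow h 1)⁻¹ * (1 - qpow h 2)) := by
    rw [qpow_neg, qpow_two]
    field_simp
    ring
  rw [h4, inv_neg, mul_inv, inv_inv]

lemma tInv_mul_tM_mul (h : ℂ) (x : Mero) : tInv h * (tM h * x) = x := by
  rw [← mul_assoc, mul_comm (tInv h), tM_mul_tInv, one_mul]

/-- The recurrence in m, divided by 1 - q²: the geometric sum is the one produced by commuting
E^{m+1} past F. -/
lemma geom_smul_xCoef {h : ℂ} (hq : ∀ n : ℕ, 0 < n → Complex.exp h ^ n ≠ 1) (l m : ℕ) :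
    (∑ j ∈ Finset.range (m + 1), (qpow h 2) ^ j) • xCoef h l (m + 1) =
      -((qpow h 2 ^ l * (qpow h 2)⁻¹) • (tM h * xCoef h l m)) := by
  have h2 := one_sub_qpow_sq_ne_zero hq
  have h3 := qpow_ne_zero h 2
  have hA : (∑ j ∈ Finset.range (m + 1), (qpow h 2) ^ j) =
      ((1 - qpow h 2) * qpow h 2)⁻¹ * ((1 - qpow h 2 ^ (m + 1)) * qpow h 2) := by
    have := mul_neg_geom_sum (qpow h 2) (m + 1)
    rw [← this]
    field_simp
  rw [hA, mul_smul, xCoef_succ_right hq, smul_neg, smul_smul]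
  congr 2
  field_simp

lemma inv_geom_eq (h : ℂ) (m : ℕ) :
    (∑ j ∈ Finset.range (m + 1), ((qpow h 2)⁻¹) ^ j) =
      ((qpow h 2)⁻¹) ^ m * ∑ j ∈ Finset.range (m + 1), (qpow h 2) ^ j := by
  have h3 := qpow_ne_zero h 2
  rw [Finset.mul_sum, ← Finset.sum_range_reflect]
  refine Finset.sum_congr rfl fun j hj => ?_
  have hj' : j ≤ m := by rw [Finset.mem_range] at hj; omega
  obtain ⟨i, rfl⟩ := Nat.exists_eq_add_of_le hj'
  rw [show j + i + 1 - 1 - j = i by omega, pow_add, inv_pow (qpow h 2) j]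
  field_simp

/-- The recurrence in m solved for the earlier coefficient, which is where t⁻¹ enters. The case m =
0 holds because the factor 1 - q^{2m} vanishes. -/
lemma xCoef_pred_right {h : ℂ} (hq : ∀ n : ℕ, 0 < n → Complex.exp h ^ n ≠ 1) (l m : ℕ) :
    (if m = 0 then 0 else xCoef h l (m - 1)) =
      ((qpow h 1 - qpow h (-1))⁻¹ * (qpow h 1 * (qpow h 2 ^ l)⁻¹ * (1 - qpow h 2 ^ m))) •
        (tInv h * xCoef h l m) := by
  rcases m with _ | m
  · simp
  have h2 := one_sub_qpow_sq_ne_zero hq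
  have h3 := qpow_ne_zero h 2
  have h1 := xCoef_succ_right hq l m
  have h4 : tM h * xCoef h l m =
      -((qpow h 2 ^ l * (1 - qpow h 2))⁻¹ • ((1 - qpow h 2 ^ (m + 1)) * qpow h 2) •
        xCoef h l (m + 1)) := by
    rw [h1, smul_neg, neg_neg, inv_smul_smul₀ (by positivity)]
  rw [if_neg m.succ_ne_zero, Nat.add_sub_cancel, ← tInv_mul_tM_mul h (xCoef h l m), h4,
    smul_smul, mul_neg, mul_smul_comm, ← neg_smul]
  congr 1
  rw [inv_qpow_sub_eq]
  rw [qpow_two] at *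
  field_simp

/-- The recurrence in l solved for the earlier coefficient. Dividing 1 - q^{2(l-1)} t² by t yields
the two terms in t⁻¹ and t; at l = 0 both have factor 0. -/
lemma xCoef_pred_left {h : ℂ} (hq : ∀ n : ℕ, 0 < n → Complex.exp h ^ n ≠ 1) (l m : ℕ) :
    (if l = 0 then 0 else qpow h 2 ^ m • xCoef h (l - 1) m) =
      ((qpow h 1 - qpow h (-1))⁻¹ * (qpow h 1 * (qpow h 2 ^ l)⁻¹ * (1 - qpow h 2 ^ l))) •
        (tInv h * xCoef h l m) -
      ((qpow h 1 - qpow h (-1))⁻¹ * ((qpow h 1)⁻¹ * (1 - qpow h 2 ^ l))) •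
        (tM h * xCoef h l m) := by
  rcases l with _ | l
  · simp
  have h2 := one_sub_qpow_sq_ne_zero hq
  have h3 := qpow_ne_zero h 2
  have h3' := qpow_ne_zero h 1
  have h1 := xCoef_succ_left hq l m
  have h4 : tM h * (qpow h 2 ^ m • xCoef h l m) =
      -((qpow h 2 ^ l * (1 - qpow h 2))⁻¹ • (1 - qpow h 2 ^ (l + 1)) •
        ((1 - qpow h 2 ^ l • tM h ^ 2) * xCoef h (l + 1) m)) := by
    rw [h1, smul_neg, neg_neg, smul_smul, mul_smul_comm]
    congr 1
    field_simp
  rw [if_neg l.succ_ne_zero, Nat.add_sub_cancel, ← tInv_mul_tM_mul h (_ • xCoef h l m), h4,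
    smul_smul, mul_neg, mul_smul_comm]
  have h5 : tInv h * ((1 - qpow h 2 ^ l • tM h ^ 2) * xCoef h (l + 1) m) =
      tInv h * xCoef h (l + 1) m - qpow h 2 ^ l • (tM h * xCoef h (l + 1) m) := by
    rw [sub_mul, one_mul, mul_sub, smul_mul_assoc, mul_smul_comm, sq, mul_assoc (tM h),
      tInv_mul_tM_mul]
  rw [h5, inv_qpow_sub_eq]
  rw [qpow_two] at *
  generalize qpow h 1 = q at *
  match_scalars <;> field_simp
  ring

lemma yCoef_eq (h : ℂ) : yCoef h =
    ((qpow h 1 - qpow h (-1))⁻¹ * (qpow h 1)⁻¹) • tM h +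
      ((qpow h 1 - qpow h (-1))⁻¹ * qpow h 1) • tInv h := by
  have h1 : ∀ c : ℂ, Meromorphic fun z => c * qpow h (-z) := fun c z =>
    (MeromorphicAt.const c z).mul (meromorphic_qpow_neg h z)
  have h2 : ∀ c : ℂ, Meromorphic fun z => c * qpow h z := fun c z =>
    (MeromorphicAt.const c z).mul (meromorphic_qpow h z)
  rw [tM, tInv, Mero.smul_of _ _ (h1 _), Mero.smul_of _ _ (h2 _),
    Mero.of_add_of _ _ (fun z => (h1 _ z).add (h2 _ z)), yCoef]
  congr 1
  funext z
  rw [sub_eq_add_neg (-z), qpow_add, qpow_add, ← qpow_neg]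
  ring

lemma nu_eq (h : ℂ) (α : ℤ) : nu h α =
    ((qpow h 1 - qpow h (-1))⁻¹ * ((qpow h 1)⁻¹ * (qpow h (-α) - 1))) • tM h +
      ((qpow h 1 - qpow h (-1))⁻¹ * (qpow h 1 * (qpow h α - 1))) • tInv h := by
  have h1 : ∀ c : ℂ, Meromorphic fun z => c * qpow h (-z) := fun c z =>
    (MeromorphicAt.const c z).mul (meromorphic_qpow_neg h z)
  have h2 : ∀ c : ℂ, Meromorphic fun z => c * qpow h z := fun c z =>
    (MeromorphicAt.const c z).mul (meromorphic_qpow h z)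
  rw [tM, tInv, Mero.smul_of _ _ (h1 _), Mero.smul_of _ _ (h2 _),
    Mero.of_add_of _ _ (fun z => (h1 _ z).add (h2 _ z)), nu]
  congr 1
  funext z
  rw [sub_eq_add_neg (-z), qpow_add, qpow_add, ← qpow_neg]
  ring

/-- The coefficient of `k⁻² - 1` in the diagonalization of `Y(λ)`. -/
def zMinus (h : ℂ) : Mero := ((qpow h 1 - qpow h (-1))⁻¹ * (qpow h 1)⁻¹) • tM h

/-- The coefficient of `k² - 1` in the diagonalization of `Y(λ)`. -/
def zPlus (h : ℂ) : Mero := ((qpow h 1 - qpow h (-1))⁻¹ * qpow h 1) • tInv h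

/-- The diagonalization `x(λ) Y(λ) x(λ)⁻¹` of `Y(λ)`. -/
def Z (h : ℂ) : UF h :=
  zMinus h ⊗ₜ (ukinv h ^ 2 - 1) + zPlus h ⊗ₜ (uk h ^ 2 - 1)

/-- `x(λ) Y(λ) = Z(λ) x(λ)`, tested against a functional that kills the high monomials. -/
lemma intertwine {h : ℂ} (hq : ∀ n : ℕ, 0 < n → Complex.exp h ^ n ≠ 1)
    {K M : Type*} [CommRing K] [Algebra ℂ K] [AddCommGroup M] [Module K M] [Module ℂ M]
    [IsScalarTower ℂ K M] (j : Mero →ₐ[ℂ] K) (g : Uq h →ₗ[ℂ] M) (N : ℕ)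
    (hg : ∀ l m, N ≤ l + 1 ∨ N ≤ m + 1 → ∀ y, g (uF h ^ l * uE h ^ m * y) = 0) :
    ∑ l ∈ Finset.range N, ∑ m ∈ Finset.range N, j (xCoef h l m) •
        (g (uF h ^ l * uE h ^ m * (uf h * uk h - ue h * uk h)) +
          j (yCoef h) • g (uF h ^ l * uE h ^ m * (uk h ^ 2 - 1))) =
      ∑ l ∈ Finset.range N, ∑ m ∈ Finset.range N, j (xCoef h l m) •
        (j (zMinus h) • g ((ukinv h ^ 2 - 1) * (uF h ^ l * uE h ^ m)) +
          j (zPlus h) • g ((uk h ^ 2 - 1) * (uF h ^ l * uE h ^ m))) := by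
  have hD := qpow_sub_ne_zero hq
  have h3 := qpow_ne_zero h 1
  have key := sum_intertwine (fun l m => j (xCoef h l m))
    (fun l m => g (uF h ^ l * uE h ^ m * uk h ^ 2))
    (fun l m => g (uF h ^ l * uE h ^ m))
    (fun l m => g (uF h ^ l * uE h ^ m * ukinv h ^ 2)) N
    (fun l m hl => hg l m (Or.inl hl) _) (fun l m hm => hg l m (Or.inr hm) _)
    (fun l m hm => hg l m (Or.inr hm) _)
    (fun m => algebraMap ℂ K (qpow h 2 ^ m))
    (fun m => algebraMap ℂ K ((qpow h 1 * (qpow h 1 - qpow h (-1))⁻¹) *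
      ∑ i ∈ Finset.range m, qpow h 2 ^ i))
    (fun m => algebraMap ℂ K ((qpow h 1 * (qpow h 1 - qpow h (-1))⁻¹) *
      ∑ i ∈ Finset.range m, ((qpow h 2)⁻¹) ^ i)) (by simp) (by simp)
    (j (yCoef h)) (j (zMinus h)) (j (zPlus h))
    (fun l m => algebraMap ℂ K (qpow h 2 ^ l * (qpow h 2 ^ m)⁻¹))
    (fun l m => algebraMap ℂ K ((qpow h 2 ^ l)⁻¹ * qpow h 2 ^ m))
    (by rw [yCoef_eq, map_add]; rfl) ?_ ?_
  · have eF : uf h * uk h = uF h * uk h ^ 2 := by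
      rw [uF, sq, mul_assoc, ← mul_assoc (ukinv h), ukinv_mul_uk, one_mul]
    have eE : ue h * uk h = uE h * uk h ^ 2 := by
      rw [uE, sq, mul_assoc, ← mul_assoc (ukinv h), ukinv_mul_uk, one_mul]
    have hkk : ukinv h ^ 2 * ukinv h ^ 2 * uk h ^ 2 = ukinv h ^ 2 := by
      rw [mul_assoc, ukinv_sq_mul_uk_sq, mul_one]
    refine Eq.trans (Finset.sum_congr rfl fun l _ => Finset.sum_congr rfl fun m _ => ?_)
      (key.trans (Finset.sum_congr rfl fun l _ => Finset.sum_congr rfl fun m _ => ?_))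
    · congr 1
      -- Normal form with powers of k on the right: fk = F k², ek = E k², and the k⁻⁴ from the
      -- commutator meets k² to give k⁻².
      have e1 : uF h ^ l * uE h ^ m * (uf h * uk h - ue h * uk h) =
          qpow h 2 ^ m • (uF h ^ (l + 1) * uE h ^ m * uk h ^ 2) +
          (((qpow h 1 * (qpow h 1 - qpow h (-1))⁻¹) * ∑ i ∈ Finset.range m, qpow h 2 ^ i) •
            (uF h ^ l * uE h ^ (m - 1) * uk h ^ 2) -
          ((qpow h 1 * (qpow h 1 - qpow h (-1))⁻¹) * ∑ i ∈ Finset.range m, ((qpow h 2)⁻¹) ^ i) •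
            (uF h ^ l * uE h ^ (m - 1) * ukinv h ^ 2)) - uF h ^ l * uE h ^ (m + 1) * uk h ^ 2 := by
        rw [eF, eE, mul_sub, ← mul_assoc, mul_assoc _ _ (uF h), uE_pow_mul_uF, ← mul_assoc _ (uE h),
          mul_assoc _ _ (uE h), ← pow_succ, mul_add, add_mul, pow_succ (uF h)]
        simp only [mul_sub, sub_mul, mul_smul_comm, smul_mul_assoc, smul_sub, smul_smul, mul_assoc]
        rw [← mul_assoc (ukinv h ^ 2), hkk, qpow_two, inv_pow]
      rw [e1, mul_sub, mul_one]
      simp only [map_add, map_sub, map_smul, algebraMap_smul]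
    · congr 1
      rw [sub_mul, sub_mul, one_mul, ← mul_assoc, ← mul_assoc, ukinv_sq_mul_uF_pow,
        uk_sq_mul_uF_pow, smul_mul_assoc, smul_mul_assoc,
        mul_assoc _ (ukinv h ^ 2) (uE h ^ m), mul_assoc _ (uk h ^ 2) (uE h ^ m),
        uk_sq_mul_uE_pow, ukinv_sq_mul_uE_pow, mul_smul_comm, mul_smul_comm, smul_smul, smul_smul]
      simp only [map_sub, map_smul, algebraMap_smul, mul_assoc, qpow_two, qpow_neg, inv_inv,
        inv_pow]
  -- Coefficient of F^l E^m k⁻²: only the commutator contributes on the Y side, and the identity is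
  -- the recurrence in m.
  · intro l m
    have h1 := congrArg (fun x => j ((qpow h 1 * (qpow h 1 - qpow h (-1))⁻¹ *
      ((qpow h 2)⁻¹) ^ m) • x)) (geom_smul_xCoef hq l m)
    simp only [smul_neg, smul_smul, map_neg, map_smul, map_mul] at h1
    have e1 : ∀ (s : ℂ) (x : K), x * algebraMap ℂ K s = s • x := fun s x => by
      rw [Algebra.smul_def, mul_comm]
    have e2 : j (zMinus h) = ((qpow h 1 - qpow h (-1))⁻¹ * (qpow h 1)⁻¹) • j (tM h) := by
      rw [zMinus, map_smul]
    rw [e1, inv_geom_eq, ← mul_assoc (qpow h 1 * _), h1, neg_neg, e2, e1, mul_smul_comm,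
      mul_smul_comm, smul_smul, mul_comm (j (tM h))]
    congr 1
    rw [qpow_two, inv_pow]
    field_simp
  -- Coefficient of F^l E^m k²: contributions from F, from the commutator, from E and from the k²
  -- term of Y. All neighbouring coefficients are rewritten as multiples of t^{±1} times the (l, m)
  -- coefficient, after which scalars are compared.
  · intro l m
    have h1 := congrArg (fun x => j ((qpow h 1 * (qpow h 1 - qpow h (-1))⁻¹) • x))
      (geom_smul_xCoef hq l m)
    have h2 := congrArg j (xCoef_pred_left hq l m)
    have h4 := congrArg j (xCoef_pred_right hq l m)
    have e1 : ∀ (s : ℂ) (x : K), x * algebraMap ℂ K s = s • x := fun s x => by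
      rw [Algebra.smul_def, mul_comm]
    have e2 : j (zPlus h) = ((qpow h 1 - qpow h (-1))⁻¹ * qpow h 1) • j (tInv h) := by
      rw [zPlus, map_smul]
    have e3 : j (yCoef h) = ((qpow h 1 - qpow h (-1))⁻¹ * (qpow h 1)⁻¹) • j (tM h) +
        ((qpow h 1 - qpow h (-1))⁻¹ * qpow h 1) • j (tInv h) := by
      rw [yCoef_eq, map_add, map_smul, map_smul]
    simp only [smul_neg, smul_smul, map_neg, map_smul, map_mul, map_sub, map_zero,
      apply_ite j] at h1 h2 h4
    simp only [e1]
    rw [h1, h2, h4, e2, e3, mul_add]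
    simp only [mul_smul_comm]
    rw [mul_comm (j (tM h)), mul_comm (j (tInv h))]
    rw [qpow_two] at *
    generalize qpow h 1 = q at *
    match_scalars <;> field_simp <;> ring

end

/-! ### Separation of eigenspaces over a commutative ring -/

section Eigen

variable {K M ι : Type*} [CommRing K] [AddCommGroup M] [Module K M]

/-- An eigenvector in a sum of eigenspaces lies in its own eigenspace. -/
lemma mem_of_mem_iSup_of_apply_eq (Z : Module.End K M) (W : ι → Submodule K M) (n : ι → K)
    (hZ : ∀ i, ∀ w ∈ W i, Z w = n i • w) (j : ι) (hn : ∀ i, i ≠ j → IsUnit (n j - n i))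
    {b : M} (hb : b ∈ ⨆ i, W i) (hZb : Z b = n j • b) : b ∈ W j := by
  classical
  obtain ⟨f, hf, rfl⟩ := (Submodule.mem_iSup_iff_exists_finsupp _ _).1 hb
  let s := f.support.erase j
  -- p(Z) kills every component of b except the j-th, and acts on b and on that component by the
  -- same unit p(n j). Hence b equals its j-th component.
  let p : Polynomial K := ∏ i ∈ s, (Polynomial.X - Polynomial.C (n i))
  have haev : ∀ (c : K) (w : M), Z w = c • w → Polynomial.aeval Z p w = p.eval c • w := by
    intro c w hw
    induction p using Polynomial.induction_on' with
    | add p q hp hq => simp only [map_add, LinearMap.add_apply, hp, hq, Polynomial.eval_add, add_smul]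
    | monomial k a =>
      have hpow : (Z ^ k) w = c ^ k • w := by
        induction k with
        | zero => simp
        | succ k ih => rw [pow_succ', Module.End.mul_apply, ih, map_smul, hw, smul_smul, pow_succ]
      simp [Polynomial.aeval_monomial, hpow, smul_smul, mul_comm]
  have hpj : IsUnit (p.eval (n j)) := by
    rw [Polynomial.eval_prod]
    refine (IsUnit.prod_iff).2 fun i hi => ?_
    simpa using hn i (Finset.ne_of_mem_erase hi)
  have hpi : ∀ i ∈ s, p.eval (n i) = 0 := by
    intro i hi
    rw [Polynomial.eval_prod]
    exact Finset.prod_eq_zero hi (by simp)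
  have h1 := haev _ _ hZb
  rw [Finsupp.sum, map_sum, Finset.sum_congr rfl fun i _ => haev (n i) (f i) (hZ i _ (hf i))] at h1
  have h2 : ∑ i ∈ f.support, p.eval (n i) • f i = p.eval (n j) • f j := by
    refine Finset.sum_eq_single j (fun i hi hij => ?_) fun hj => ?_
    · rw [hpi i (Finset.mem_erase.2 ⟨hij, hi⟩), zero_smul]
    · rw [Finsupp.notMem_support_iff.1 hj, smul_zero]
  rw [h2] at h1
  have h3 := hpj.smul_left_cancel.1 h1
  rw [Finsupp.sum, ← h3]
  exact hf j

end Eigen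

/-! ### Finite-dimensional orbits and the weight decomposition of A -/

noncomputable section

lemma regLeft_mul (h : ℂ) (u u' : Uq h) : regLeft h (u * u') = regLeft h u * regLeft h u' := by
  ext a v
  change (a : Module.Dual ℂ (Uq h)) (v * (u * u')) = (a : Module.Dual ℂ (Uq h)) (v * u * u')
  rw [mul_assoc]

lemma regRight_mul (h : ℂ) (u u' : Uq h) :
    regRight h (u * u') = regRight h u' * regRight h u := by
  ext a v
  change (a : Module.Dual ℂ (Uq h)) (u * u' * v) = (a : Module.Dual ℂ (Uq h)) (u * (u' * v))
  rw [mul_assoc]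

lemma regLeft_one (h : ℂ) : regLeft h 1 = 1 := by
  ext a v
  change (a : Module.Dual ℂ (Uq h)) (v * 1) = (a : Module.Dual ℂ (Uq h)) v
  rw [mul_one]

lemma regRight_one (h : ℂ) : regRight h 1 = 1 := by
  ext a v
  change (a : Module.Dual ℂ (Uq h)) (1 * v) = (a : Module.Dual ℂ (Uq h)) v
  rw [one_mul]

lemma regLeft_comm_regRight (h : ℂ) (u u' : Uq h) :
    Commute (regLeft h u) (regRight h u') := by
  change _ = _
  ext a v
  change (a : Module.Dual ℂ (Uq h)) (u' * (v * u)) = (a : Module.Dual ℂ (Uq h)) (u' * v * u)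
  rw [mul_assoc]

/-- If the orbits of matrix coefficients under an action of `U` on `A` are finite dimensional, then
so are all orbits. -/
lemma finiteDimensional_range_of_matCoef {h : ℂ} (r : Uq h →ₗ[ℂ] Module.End ℂ (Aq h))
    (hr : ∀ a : Aq h, IsMatCoef h a → ∃ V : Submodule ℂ (Module.Dual ℂ (Uq h)),
      FiniteDimensional ℂ V ∧ ∀ u, (r u a : Module.Dual ℂ (Uq h)) ∈ V) (a : Aq h) :
    FiniteDimensional ℂ (LinearMap.range (r.flip a)) := by
  obtain ⟨a, ha⟩ := a
  induction ha using Submodule.span_induction with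
  | mem a ha =>
    obtain ⟨V, hV, hu⟩ := hr ⟨a, Submodule.subset_span ha⟩ ha
    have hle : ∀ x ∈ LinearMap.range (r.flip ⟨a, Submodule.subset_span ha⟩),
        (Aq h).subtype x ∈ V := by
      rintro _ ⟨u, rfl⟩
      exact hu u
    exact Module.Finite.of_injective ((Aq h).subtype.restrict hle) fun x y hxy =>
      Subtype.ext (Subtype.ext (congrArg (fun z : V => (z : Module.Dual ℂ (Uq h))) hxy))
  | zero =>
    have : r.flip ⟨0, Submodule.zero_mem _⟩ = 0 := map_zero r.flip
    rw [this, LinearMap.range_zero]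
    infer_instance
  | add a b ha hb iha ihb =>
    have : r.flip ⟨a + b, Submodule.add_mem _ ha hb⟩ = r.flip ⟨a, ha⟩ + r.flip ⟨b, hb⟩ :=
      map_add r.flip ⟨a, ha⟩ ⟨b, hb⟩
    rw [this]
    exact Submodule.finiteDimensional_of_le (LinearMap.range_add_le _ _)
  | smul c a ha iha =>
    have : r.flip ⟨c • a, Submodule.smul_mem _ c ha⟩ = c • r.flip ⟨a, ha⟩ :=
      map_smul r.flip c ⟨a, ha⟩
    rw [this]
    refine Submodule.finiteDimensional_of_le (S₂ := LinearMap.range (r.flip ⟨a, ha⟩)) ?_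
    rintro _ ⟨u, rfl⟩
    exact Submodule.smul_mem _ c ⟨u, rfl⟩

/-- For a matrix coefficient, (u · a)(w) = ξ(ρ(w) ρ(u) v) depends on u only through ρ(u), so the
orbit lies in a linear image of the finite-dimensional End V. -/
lemma finiteDimensional_range_regLeft (h : ℂ) (a : Aq h) :
    FiniteDimensional ℂ (LinearMap.range ((regLeft h).flip a)) := by
  refine finiteDimensional_range_of_matCoef (regLeft h) ?_ a
  rintro a ⟨n, ρ, -, v, ξ, hb⟩
  let ψ : Module.End ℂ (Fin n → ℂ) →ₗ[ℂ] Module.Dual ℂ (Uq h) :=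
    { toFun := fun φ => ξ ∘ₗ (LinearMap.applyₗ (φ v)) ∘ₗ ρ.toLinearMap
      map_add' := fun φ φ' => by ext; simp
      map_smul' := fun c φ => by ext; simp }
  refine ⟨LinearMap.range ψ, inferInstance, fun u => ⟨ρ u, ?_⟩⟩
  ext w
  change ξ (ρ w (ρ u v)) = (a : Module.Dual ℂ (Uq h)) (w * u)
  rw [hb, map_mul]
  rfl

lemma finiteDimensional_range_regRight (h : ℂ) (a : Aq h) :
    FiniteDimensional ℂ (LinearMap.range ((regRight h).flip a)) := by
  refine finiteDimensional_range_of_matCoef (regRight h) ?_ a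
  rintro a ⟨n, ρ, -, v, ξ, hb⟩
  let ψ : Module.End ℂ (Fin n → ℂ) →ₗ[ℂ] Module.Dual ℂ (Uq h) :=
    { toFun := fun φ => ξ ∘ₗ φ ∘ₗ (LinearMap.applyₗ v) ∘ₗ ρ.toLinearMap
      map_add' := fun φ φ' => by ext; simp
      map_smul' := fun c φ => by ext; simp }
  refine ⟨LinearMap.range ψ, inferInstance, fun u => ⟨ρ u, ?_⟩⟩
  ext w
  change ξ (ρ u (ρ w v)) = (a : Module.Dual ℂ (Uq h)) (u * w)
  rw [hb, map_mul]
  rfl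

lemma apply_ukUnit_zpow {h : ℂ} {V : Type*} [AddCommGroup V] [Module ℂ V]
    (ρ : Uq h →ₐ[ℂ] Module.End ℂ V) {s : ℂ} {w : V} (hw : ρ (uk h) w = qpow h s • w) (m : ℤ) :
    ρ ((ukUnit h ^ m : (Uq h)ˣ) : Uq h) w = qpow h (m * s) • w := by
  have hinv : ρ (ukinv h) w = qpow h (-s) • w := by
    have h1 : ρ (ukinv h) (ρ (uk h) w) = w := by
      rw [← Module.End.mul_apply, ← map_mul, ukinv_mul_uk, map_one, Module.End.one_apply]
    rw [hw, map_smul] at h1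
    rw [qpow_neg, eq_inv_smul_iff₀ (qpow_ne_zero _ _), h1]
  induction m using Int.induction_on with
  | zero => simp [qpow_zero]
  | succ m ih =>
    rw [zpow_add_one, Units.val_mul, map_mul, Module.End.mul_apply]
    change ρ _ (ρ (uk h) w) = _
    rw [hw, map_smul, ih, smul_smul, ← qpow_add]
    congr 2
    push_cast
    ring
  | pred m ih =>
    rw [zpow_sub_one, Units.val_mul, map_mul, Module.End.mul_apply]
    change ρ _ (ρ (ukinv h) w) = _
    rw [hinv, map_smul, ih, smul_smul, ← qpow_add]
    congr 2
    push_cast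
    ring

/-- In a basis of eigenvectors of k, the (i, j) matrix coefficient of a type 1 representation has
left weight r j and right weight r i, and every matrix coefficient is a combination of these. The
outer supremum runs over β because the eigenvalue for the left action is isolated first later on. -/
lemma iSup_weightSpace (h : ℂ) : ⨆ β : ℤ, ⨆ α : ℤ, weightSpace h α β = ⊤ := by
  rw [eq_top_iff]
  rintro ⟨a, ha⟩ -
  induction ha using Submodule.span_induction with
  | mem a ha =>
    obtain ⟨n, ρ, hρ, v, ξ, hb⟩ := ha
    let s : Set (Fin n → ℂ) :=
      ⋃ r : ℤ, ((ρ (uk h)).eigenspace (qpow h ((r : ℂ) / 2)) : Set (Fin n → ℂ))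
    have hs : ⊤ ≤ Submodule.span ℂ s := by
      rw [← hρ]
      exact iSup_le fun r => le_trans Submodule.subset_span
        (Submodule.span_mono (Set.subset_iUnion (fun r : ℤ =>
          ((ρ (uk h)).eigenspace (qpow h ((r : ℂ) / 2)) : Set (Fin n → ℂ))) r))
    -- Type 1 says that eigenvectors of k span, so a basis can be extracted from them.
    let b := Module.Basis.ofSpan hs
    have hbs : ∀ i, ∃ r : ℤ, ρ (uk h) (b i) = qpow h ((r : ℂ) / 2) • b i := by
      intro i
      obtain ⟨r, hr⟩ := Set.mem_iUnion.1 (Module.Basis.ofSpan_subset hs ⟨i, rfl⟩)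
      exact ⟨r, Module.End.mem_eigenspace_iff.1 hr⟩
    choose r hr using hbs
    have := FiniteDimensional.fintypeBasisIndex b
    have hk : ∀ (m : ℤ) i, ρ ((ukUnit h ^ m : (Uq h)ˣ) : Uq h) (b i) =
        qpow h (m * r i / 2) • b i := by
      intro m i
      rw [mul_div_assoc]
      exact apply_ukUnit_zpow ρ (hr i) m
    have hkc : ∀ (m : ℤ) i w, b.coord i (ρ ((ukUnit h ^ m : (Uq h)ˣ) : Uq h) w) =
        qpow h (m * r i / 2) * b.coord i w := by
      intro m i w
      have : b.coord i ∘ₗ ρ ((ukUnit h ^ m : (Uq h)ˣ) : Uq h) =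
          qpow h (m * r i / 2) • b.coord i := by
        refine b.ext fun j => ?_
        rw [LinearMap.comp_apply, hk, map_smul, LinearMap.smul_apply, b.coord_apply,
          b.repr_self, Finsupp.single_apply]
        split_ifs with hij
        · rw [hij]
        · rw [smul_zero, smul_zero]
      exact LinearMap.congr_fun this w
    let c : ∀ i j, Aq h := fun i j =>
      ⟨b.coord i ∘ₗ (LinearMap.applyₗ (b j)) ∘ₗ ρ.toLinearMap,
        Submodule.subset_span ⟨n, ρ, hρ, b j, b.coord i, fun _ => rfl⟩⟩
    have hc : ∀ i j, c i j ∈ ⨆ β : ℤ, ⨆ α : ℤ, weightSpace h α β := by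
      intro i j
      refine Submodule.mem_iSup_of_mem (r j) (Submodule.mem_iSup_of_mem (r i) ?_)
      refine Submodule.mem_iInf _ |>.2 fun m => ⟨?_, ?_⟩
      · refine Module.End.mem_eigenspace_iff.2 (Subtype.ext (LinearMap.ext fun w => ?_))
        change b.coord i (ρ (w * _) (b j)) = qpow h (m * r j / 2) • b.coord i (ρ w (b j))
        rw [map_mul, Module.End.mul_apply, hk, map_smul, map_smul]
      · refine Module.End.mem_eigenspace_iff.2 (Subtype.ext (LinearMap.ext fun w => ?_))
        change b.coord i (ρ (_ * w) (b j)) = qpow h (m * r i / 2) • b.coord i (ρ w (b j))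
        rw [map_mul, Module.End.mul_apply, hkc, smul_eq_mul]
    have hsum : (⟨a, Submodule.subset_span ⟨n, ρ, hρ, v, ξ, hb⟩⟩ : Aq h) =
        ∑ i, ∑ j, (ξ (b i) * b.coord j v) • c i j := by
      refine Subtype.ext (LinearMap.ext fun u => ?_)
      rw [AddSubmonoidClass.coe_finsetSum, LinearMap.sum_apply]
      change a u = _
      rw [hb, ← b.sum_repr (ρ u v), map_sum]
      refine Finset.sum_congr rfl fun i _ => ?_
      rw [AddSubmonoidClass.coe_finsetSum, LinearMap.sum_apply, map_smul, smul_eq_mul, mul_comm]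
      nth_rewrite 1 [← b.sum_repr v]
      rw [map_sum, map_sum, Finset.sum_apply', Finset.mul_sum]
      refine Finset.sum_congr rfl fun j _ => ?_
      rw [map_smul, map_smul, Finsupp.smul_apply, smul_eq_mul, ← mul_assoc]
      rfl
    rw [hsum]
    exact Submodule.sum_mem _ fun i _ => Submodule.sum_mem _ fun j _ =>
      Submodule.smul_mem _ _ (hc i j)
  | zero => exact Submodule.zero_mem _
  | add a b ha hb iha ihb => exact Submodule.add_mem _ iha ihb
  | smul c a ha iha => exact Submodule.smul_mem _ c iha

/-! ### Separation of the eigenvalues ν -/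

lemma qpow_intCast_injective {h : ℂ} (hq : ∀ n : ℕ, 0 < n → Complex.exp h ^ n ≠ 1) :
    Function.Injective fun n : ℤ => qpow h n := by
  have hz : ∀ n : ℤ, qpow h n = Complex.exp h ^ n := by
    intro n
    rw [qpow, mul_comm, Complex.exp_int_mul]
  intro a b hab
  simp only [hz] at hab
  by_contra hne
  have h1 : Complex.exp h ^ (a - b) = 1 := by
    rw [zpow_sub₀ (Complex.exp_ne_zero h), hab, div_self (zpow_ne_zero _ (Complex.exp_ne_zero h))]
  have h2 : Complex.exp h ^ (a - b).natAbs = 1 := by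
    rcases Int.natAbs_eq (a - b) with h3 | h3
    · rwa [h3, zpow_natCast] at h1
    · rwa [h3, zpow_neg, inv_eq_one, zpow_natCast] at h1
  exact hq _ (Int.natAbs_pos.2 (sub_ne_zero.2 hne)) h2

lemma isUnit_nu_sub {h : ℂ} (hq : ∀ n : ℕ, 0 < n → Complex.exp h ^ n ≠ 1) {α β : ℤ}
    (hαβ : β ≠ α) : IsUnit (nu h α - nu h β) := by
  let δ := (qpow h 1 - qpow h (-1))⁻¹
  -- d is t (ν_α - ν_β) written as a polynomial in t; its constant term is a nonzero multiple of q^α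
  -- - q^β.
  let d : Polynomial ℂ := Polynomial.C (δ * (qpow h 1 * (qpow h α - qpow h β))) +
    Polynomial.C (δ * ((qpow h 1)⁻¹ * (qpow h (-α) - qpow h (-β)))) * Polynomial.X ^ 2
  have hd : d ≠ 0 := by
    intro h0
    have h1 : d.eval 0 = 0 := by rw [h0, Polynomial.eval_zero]
    have h2 : δ * (qpow h 1 * (qpow h α - qpow h β)) = 0 := by simpa [d] using h1
    refine mul_ne_zero (inv_ne_zero (qpow_sub_ne_zero hq)) (mul_ne_zero (qpow_ne_zero _ _) ?_) h2
    exact sub_ne_zero.2 fun h3 => hαβ (qpow_intCast_injective hq h3).symm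
  have h1 : nu h α - nu h β = tInv h * Polynomial.aeval (tM h) d := by
    have h2 : Polynomial.aeval (tM h) d = (δ * (qpow h 1 * (qpow h α - qpow h β))) • (1 : Mero) +
        (δ * ((qpow h 1)⁻¹ * (qpow h (-α) - qpow h (-β)))) • (tM h * tM h) := by
      simp [d, Algebra.smul_def, sq]
    rw [h2, mul_add, mul_smul_comm, mul_smul_comm, tInv_mul_tM_mul, mul_one, nu_eq, nu_eq]
    module
  rw [h1]
  exact (IsUnit.of_mul_eq_one (tM h) (by rw [mul_comm, tM_mul_tInv])).mul
    (isUnit_aeval_tM (ne_zero_of_not_root hq) hd)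

/-! ### The actions on A_K and invertibility of x -/

lemma actLeft_tmul (h : ℂ) (c : Coef) (u : Uq h) (a : Aq h) :
    actLeft h (c ⊗ₜ u) (1 ⊗ₜ a) = c • (1 ⊗ₜ regLeft h u a : AK h) := by
  rw [actLeft, extendAct_tmul, TensorProduct.smul_tmul', smul_eq_mul]

lemma actRight_tmul (h : ℂ) (c : Coef) (u : Uq h) (a : Aq h) :
    actRight h (c ⊗ₜ u) (1 ⊗ₜ a) = c • (1 ⊗ₜ regRight h u a : AK h) := by
  rw [actRight, extendAct_tmul, TensorProduct.smul_tmul', smul_eq_mul]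

lemma extendAct_eq_smul (h : ℂ) (r : Uq h →ₗ[ℂ] Module.End ℂ (Aq h)) (c : Coef) (u : Uq h) :
    extendAct h r (c ⊗ₜ u) = c • (r u).baseChange Coef := rfl

lemma atMu_tmul (h : ℂ) (c : Mero) (u : Uq h) : atMu h (c ⊗ₜ u) = inMu c ⊗ₜ u := rfl

lemma atLam_tmul (h : ℂ) (c : Mero) (u : Uq h) : atLam h (c ⊗ₜ u) = inLam c ⊗ₜ u := rfl

lemma xTerm_eq (h : ℂ) (p : ℕ × ℕ) :
    xTerm h p = xCoef h p.1 p.2 ⊗ₜ (uF h ^ p.1 * uE h ^ p.2) := rfl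

lemma commute_actLeft_actRight (h : ℂ) (u u' : UK h) :
    Commute (actLeft h u) (actRight h u') := by
  induction u using TensorProduct.induction_on with
  | zero => rw [map_zero]; exact Commute.zero_left _
  | add x y hx hy => rw [map_add]; exact hx.add_left hy
  | tmul c u =>
    induction u' using TensorProduct.induction_on with
    | zero => rw [map_zero]; exact Commute.zero_right _
    | add x y hx hy => rw [map_add]; exact hx.add_right hy
    | tmul c' u' =>
      rw [actLeft, actRight, extendAct_eq_smul, extendAct_eq_smul]
      refine Commute.smul_left (Commute.smul_right ?_ _) _
      change LinearMap.baseChange Coef _ ∘ₗ LinearMap.baseChange Coef _ =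
        LinearMap.baseChange Coef _ ∘ₗ LinearMap.baseChange Coef _
      rw [← LinearMap.baseChange_comp, ← LinearMap.baseChange_comp]
      congr 1
      exact regLeft_comm_regRight h u u'

lemma commute_locSum {R M ι : Type*} [CommRing R] [AddCommGroup M] [Module R M]
    (S : ι → Module.End R M) (hS : ∀ z, {i | S i z ≠ 0}.Finite) (T : Module.End R M)
    (hT : ∀ i, Commute T (S i)) : Commute T (locSum S hS) := by
  ext z
  change T (∑ᶠ i, S i z) = ∑ᶠ i, S i (T z)
  rw [map_finsum T (hS z)]
  exact finsum_congr fun i => LinearMap.congr_fun (hT i) z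

lemma locSum_apply_eq_sum {R M : Type*} [CommRing R] [AddCommGroup M] [Module R M]
    (S : ℕ × ℕ → Module.End R M) (hS : ∀ z, {i | S i z ≠ 0}.Finite) (z : M) (N : ℕ)
    (hN : ∀ l m, N ≤ l ∨ N ≤ m → S (l, m) z = 0) :
    locSum S hS z = ∑ l ∈ Finset.range N, ∑ m ∈ Finset.range N, S (l, m) z := by
  change ∑ᶠ i, S i z = _
  rw [finsum_eq_sum_of_support_subset (s := Finset.range N ×ˢ Finset.range N),
    Finset.sum_product]
  rintro ⟨l, m⟩ hp
  by_contra hlm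
  refine hp (hN l m ?_)
  simp only [Finset.coe_product, Set.mem_prod, Finset.coe_range, Set.mem_Iio] at hlm
  omega

/-- An instance of `isUnit_locSum` with t = q^{-μ}, the orbits U · a serving as the stable
finite-dimensional subspaces. -/
lemma isUnit_xLeft (h : ℂ) (hq : ∀ n : ℕ, 0 < n → Complex.exp h ^ n ≠ 1) :
    IsUnit (xLeft h hq) := by
  have h0 := ne_zero_of_not_root hq
  refine isUnit_locSum regEval (inMu.comp (regSubst h0))
    (fun p => regLeft h (uF h ^ p.1 * uE h ^ p.2)) (xReg h) (0, 0) ?_ ?_ ?_ ?_ ?_ _ _ ?_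
  · rw [pow_zero, pow_zero, mul_one, regLeft_one]
  · rw [regEval_xReg, if_pos rfl]
  · intro p hp
    rw [regEval_xReg, if_neg hp]
  · intro a
    obtain ⟨N, hN⟩ := mono_eventually_zero h hq a a.2
    refine ((Set.finite_Iio N).prod (Set.finite_Iio N)).subset fun p hp => ?_
    by_contra hp'
    refine hp (Subtype.ext (LinearMap.ext fun v => ?_))
    have := hN p.1 p.2 (by rw [Set.mem_prod, Set.mem_Iio, Set.mem_Iio] at hp'; omega) v 1
    rwa [mul_one] at this
  · intro a
    refine ⟨_, ⟨finiteDimensional_range_regLeft h a, ?_⟩, 1, ?_⟩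
    · rintro p _ ⟨u, rfl⟩
      exact ⟨uF h ^ p.1 * uE h ^ p.2 * u, by
        rw [LinearMap.flip_apply, regLeft_mul]; rfl⟩
    · rw [LinearMap.flip_apply, regLeft_one]; rfl
  · intro p
    rw [AlgHom.comp_apply, regSubst_xReg]
    rfl

lemma isUnit_xRight (h : ℂ) (hq : ∀ n : ℕ, 0 < n → Complex.exp h ^ n ≠ 1) :
    IsUnit (xRight h hq) := by
  have h0 := ne_zero_of_not_root hq
  refine isUnit_locSum regEval (inLam.comp (regSubst h0))
    (fun p => regRight h (uF h ^ p.1 * uE h ^ p.2)) (xReg h) (0, 0) ?_ ?_ ?_ ?_ ?_ _ _ ?_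
  · rw [pow_zero, pow_zero, mul_one, regRight_one]
  · rw [regEval_xReg, if_pos rfl]
  · intro p hp
    rw [regEval_xReg, if_neg hp]
  · intro a
    obtain ⟨N, hN⟩ := mono_eventually_zero h hq a a.2
    refine ((Set.finite_Iio N).prod (Set.finite_Iio N)).subset fun p hp => ?_
    by_contra hp'
    refine hp (Subtype.ext (LinearMap.ext fun v => ?_))
    have := hN p.1 p.2 (by rw [Set.mem_prod, Set.mem_Iio, Set.mem_Iio] at hp'; omega) 1 v
    rwa [one_mul] at this
  · intro a
    refine ⟨_, ⟨finiteDimensional_range_regRight h a, ?_⟩, 1, ?_⟩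
    · rintro p _ ⟨u, rfl⟩
      exact ⟨u * (uF h ^ p.1 * uE h ^ p.2), by
        rw [LinearMap.flip_apply, regRight_mul]; rfl⟩
    · rw [LinearMap.flip_apply, regRight_one]; rfl
  · intro p
    rw [AlgHom.comp_apply, regSubst_xReg]
    rfl

/-! ### The intertwining relation as an identity of operators -/

lemma xLeft_mul_Y (h : ℂ) (hq : ∀ n : ℕ, 0 < n → Complex.exp h ^ n ≠ 1) :
    xLeft h hq * actLeft h (atMu h (Y h)) = actLeft h (atMu h (Z h)) * xLeft h hq := by
  refine TensorProduct.AlgebraTensorModule.curry_injective (LinearMap.ext_ring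
    (LinearMap.ext fun a => ?_))
  change xLeft h hq (actLeft h (atMu h (Y h)) (1 ⊗ₜ a)) =
    actLeft h (atMu h (Z h)) (xLeft h hq (1 ⊗ₜ a))
  obtain ⟨N, hN⟩ := mono_eventually_zero h hq a a.2
  let g : Uq h →ₗ[ℂ] AK h := TensorProduct.mk ℂ Coef (Aq h) 1 ∘ₗ (regLeft h).flip a
  -- The cutoff N + 1 makes the hypothesis of `intertwine` say N ≤ l or N ≤ m, which is what
  -- annihilation of a provides.
  have hg : ∀ l m, N + 1 ≤ l + 1 ∨ N + 1 ≤ m + 1 → ∀ y, g (uF h ^ l * uE h ^ m * y) = 0 := by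
    intro l m hlm y
    have : regLeft h (uF h ^ l * uE h ^ m * y) a = 0 := by
      refine Subtype.ext (LinearMap.ext fun v => ?_)
      have := hN l m (by omega) v y
      rwa [mul_assoc] at this
    change (1 : Coef) ⊗ₜ[ℂ] regLeft h (uF h ^ l * uE h ^ m * y) a = 0
    rw [this, TensorProduct.tmul_zero]
  have hYa : ∀ l m, actLeft h (atMu h (xTerm h (l, m))) (actLeft h (atMu h (Y h)) (1 ⊗ₜ a)) =
      inMu (xCoef h l m) • (g (uF h ^ l * uE h ^ m * (uf h * uk h - ue h * uk h)) +
          inMu (yCoef h) • g (uF h ^ l * uE h ^ m * (uk h ^ 2 - 1))) := by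
    intro l m
    rw [xTerm_eq, Y, map_add, atMu_tmul, atMu_tmul, atMu_tmul, map_add, LinearMap.add_apply,
      actLeft_tmul, actLeft_tmul, map_add, map_smul, map_smul, actLeft_tmul, actLeft_tmul,
      map_one, one_smul, smul_comm (inMu (yCoef h)), ← smul_add]
    simp only [g, LinearMap.comp_apply, LinearMap.flip_apply, regLeft_mul h (_ * _),
      TensorProduct.mk_apply, Module.End.mul_apply]
  have hXa : ∀ l m, actLeft h (atMu h (xTerm h (l, m))) (1 ⊗ₜ a) =
      inMu (xCoef h l m) • g (uF h ^ l * uE h ^ m) := by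
    intro l m
    rw [xTerm_eq, atMu_tmul, actLeft_tmul]
    rfl
  have hZa : ∀ l m, actLeft h (atMu h (Z h)) (g (uF h ^ l * uE h ^ m)) =
      inMu (zMinus h) • g ((ukinv h ^ 2 - 1) * (uF h ^ l * uE h ^ m)) +
          inMu (zPlus h) • g ((uk h ^ 2 - 1) * (uF h ^ l * uE h ^ m)) := by
    intro l m
    simp only [g, LinearMap.comp_apply, LinearMap.flip_apply, regLeft_mul h (_ - _),
      TensorProduct.mk_apply, Module.End.mul_apply]
    rw [Z, map_add, atMu_tmul, atMu_tmul, map_add, LinearMap.add_apply, actLeft_tmul, actLeft_tmul]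
  rw [xLeft, locSum_apply_eq_sum _ _ _ (N + 1), locSum_apply_eq_sum _ _ _ (N + 1), map_sum]
  · simp only [hYa, map_sum, hXa, map_smul, hZa]
    exact intertwine hq inMu g (N + 1) hg
  · intro l m hlm
    rw [hXa, ← mul_one (uF h ^ l * uE h ^ m), hg l m (by omega), smul_zero]
  · intro l m hlm
    rw [hYa, hg l m (by omega), hg l m (by omega), smul_zero, add_zero, smul_zero]

/-- The right action reverses products: (a · x) · Y = a · (x Y) = a · (Z x) = (a · Z) · x. The same
relation x Y = Z x therefore serves on both sides. -/
lemma Y_mul_xRight (h : ℂ) (hq : ∀ n : ℕ, 0 < n → Complex.exp h ^ n ≠ 1) :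
    actRight h (atLam h (Y h)) * xRight h hq = xRight h hq * actRight h (atLam h (Z h)) := by
  refine TensorProduct.AlgebraTensorModule.curry_injective (LinearMap.ext_ring
    (LinearMap.ext fun a => ?_))
  change actRight h (atLam h (Y h)) (xRight h hq (1 ⊗ₜ a)) =
    xRight h hq (actRight h (atLam h (Z h)) (1 ⊗ₜ a))
  obtain ⟨N, hN⟩ := mono_eventually_zero h hq a a.2
  let g : Uq h →ₗ[ℂ] AK h := TensorProduct.mk ℂ Coef (Aq h) 1 ∘ₗ (regRight h).flip a
  have hg' : ∀ l m, N + 1 ≤ l + 1 ∨ N + 1 ≤ m + 1 → ∀ x y,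
      g (x * (uF h ^ l * uE h ^ m) * y) = 0 := by
    intro l m hlm x y
    have : regRight h (x * (uF h ^ l * uE h ^ m) * y) a = 0 := by
      refine Subtype.ext (LinearMap.ext fun v => ?_)
      have := hN l m (by omega) x (y * v)
      rwa [← mul_assoc] at this
    change (1 : Coef) ⊗ₜ[ℂ] regRight h (x * (uF h ^ l * uE h ^ m) * y) a = 0
    rw [this, TensorProduct.tmul_zero]
  have hg : ∀ l m, N + 1 ≤ l + 1 ∨ N + 1 ≤ m + 1 → ∀ y, g (uF h ^ l * uE h ^ m * y) = 0 := by
    intro l m hlm y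
    rw [← one_mul (uF h ^ l * uE h ^ m), hg' l m hlm]
  have hYa : ∀ l m, actRight h (atLam h (Y h)) (g (uF h ^ l * uE h ^ m)) =
      g (uF h ^ l * uE h ^ m * (uf h * uk h - ue h * uk h)) +
          inLam (yCoef h) • g (uF h ^ l * uE h ^ m * (uk h ^ 2 - 1)) := by
    intro l m
    simp only [g, LinearMap.comp_apply, LinearMap.flip_apply, regRight_mul h (_ * _),
      TensorProduct.mk_apply, Module.End.mul_apply]
    rw [Y, map_add, atLam_tmul, atLam_tmul, map_add, LinearMap.add_apply, actRight_tmul,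
      actRight_tmul, map_one, one_smul]
  have hXa : ∀ l m, actRight h (atLam h (xTerm h (l, m))) (1 ⊗ₜ a) =
      inLam (xCoef h l m) • g (uF h ^ l * uE h ^ m) := by
    intro l m
    rw [xTerm_eq, atLam_tmul, actRight_tmul]
    rfl
  have hZa : ∀ l m, actRight h (atLam h (xTerm h (l, m))) (actRight h (atLam h (Z h)) (1 ⊗ₜ a)) =
      inLam (xCoef h l m) • (inLam (zMinus h) • g ((ukinv h ^ 2 - 1) * (uF h ^ l * uE h ^ m)) +
          inLam (zPlus h) • g ((uk h ^ 2 - 1) * (uF h ^ l * uE h ^ m))) := by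
    intro l m
    rw [xTerm_eq, Z, map_add, atLam_tmul, atLam_tmul, atLam_tmul, map_add, LinearMap.add_apply,
      actRight_tmul, actRight_tmul, map_add, map_smul, map_smul, actRight_tmul, actRight_tmul,
      smul_comm (inLam (zMinus h)), smul_comm (inLam (zPlus h)), ← smul_add]
    simp only [g, LinearMap.comp_apply, LinearMap.flip_apply, regRight_mul h (_ - _),
      TensorProduct.mk_apply, Module.End.mul_apply]
  rw [xRight, locSum_apply_eq_sum _ _ _ (N + 1), locSum_apply_eq_sum _ _ _ (N + 1), map_sum]
  · simp only [hYa, map_sum, hXa, map_smul, hZa]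
    exact intertwine hq inLam g (N + 1) hg
  · intro l m hlm
    rw [hZa, ← mul_one (_ * (uF h ^ l * uE h ^ m)), hg' l m (by omega),
      ← mul_one (_ * (uF h ^ l * uE h ^ m)), hg' l m (by omega), smul_zero, smul_zero, add_zero,
      smul_zero]
  · intro l m hlm
    rw [hXa, ← mul_one (uF h ^ l * uE h ^ m), hg l m (by omega), smul_zero]

/-! ### Weight spaces as joint eigenspaces of Z -/

lemma iSup_weightSpaceK (h : ℂ) : ⨆ β : ℤ, ⨆ α : ℤ, weightSpaceK h α β = ⊤ := by
  have hle : ⨆ β : ℤ, ⨆ α : ℤ, weightSpace h α β ≤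
      ((⨆ β : ℤ, ⨆ α : ℤ, weightSpaceK h α β).restrictScalars ℂ).comap
        (TensorProduct.mk ℂ Coef (Aq h) 1) := by
    refine iSup_le fun β => iSup_le fun α => fun a ha => ?_
    refine Submodule.mem_iSup_of_mem β (Submodule.mem_iSup_of_mem α ?_)
    exact Submodule.tmul_mem_baseChange_of_mem 1 ha
  rw [iSup_weightSpace] at hle
  rw [eq_top_iff]
  rintro z -
  induction z using TensorProduct.induction_on with
  | zero => exact Submodule.zero_mem _
  | add x y hx hy => exact Submodule.add_mem _ hx hy
  | tmul c a =>
    have h1 : c ⊗ₜ[ℂ] a = c • ((1 : Coef) ⊗ₜ[ℂ] a) := by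
      rw [TensorProduct.smul_tmul', smul_eq_mul, mul_one]
    rw [h1]
    exact Submodule.smul_mem _ c (hle (Submodule.mem_top (x := a)))

lemma ukUnit_zpow_two (h : ℂ) : ((ukUnit h ^ (2 : ℤ) : (Uq h)ˣ) : Uq h) = uk h ^ 2 := rfl

lemma ukUnit_zpow_neg_two (h : ℂ) :
    ((ukUnit h ^ (-2 : ℤ) : (Uq h)ˣ) : Uq h) = ukinv h ^ 2 := by
  rw [zpow_neg, ← inv_zpow]
  rfl

lemma nu_eq_zMinus_add_zPlus (h : ℂ) (α : ℤ) :
    nu h α = (qpow h (-α) - 1) • zMinus h + (qpow h α - 1) • zPlus h := by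
  rw [nu_eq, zMinus, zPlus]
  module

lemma actLeft_Z_weightSpaceK {h : ℂ} {α β : ℤ} {b : AK h} (hb : b ∈ weightSpaceK h α β) :
    actLeft h (atMu h (Z h)) b = inMu (nu h β) • b := by
  refine Module.End.mem_eigenspace_iff.1 ?_
  revert b
  change weightSpaceK h α β ≤ _
  rw [weightSpaceK, Submodule.baseChange_eq_span, Submodule.span_le]
  rintro _ ⟨a, ha, rfl⟩
  refine Module.End.mem_eigenspace_iff.2 ?_
  -- Only k² and k⁻² occur in Z, so the weight condition is used for m = 2 and m = -2.
  have hk := fun m => Module.End.mem_eigenspace_iff.1 ((Submodule.mem_iInf _).1 ha m).1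
  have h2 := hk 2
  have h2' := hk (-2)
  rw [ukUnit_zpow_two] at h2
  rw [ukUnit_zpow_neg_two] at h2'
  have e1 : ((2 : ℤ) : ℂ) * (β : ℂ) / 2 = β := by push_cast; ring
  have e2 : ((-2 : ℤ) : ℂ) * (β : ℂ) / 2 = -β := by push_cast; ring
  rw [e1] at h2
  rw [e2] at h2'
  rw [Z, map_add, atMu_tmul, atMu_tmul, map_add, LinearMap.add_apply, TensorProduct.mk_apply,
    actLeft_tmul, actLeft_tmul, map_sub, map_sub, regLeft_one, LinearMap.sub_apply,
    LinearMap.sub_apply, h2, h2', Module.End.one_apply, nu_eq_zMinus_add_zPlus, map_add, map_smul,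
    map_smul]
  simp only [TensorProduct.tmul_sub, TensorProduct.tmul_smul]
  rw [add_smul, smul_assoc, smul_assoc]
  module

lemma actRight_Z_weightSpaceK {h : ℂ} {α β : ℤ} {b : AK h} (hb : b ∈ weightSpaceK h α β) :
    actRight h (atLam h (Z h)) b = inLam (nu h α) • b := by
  refine Module.End.mem_eigenspace_iff.1 ?_
  revert b
  change weightSpaceK h α β ≤ _
  rw [weightSpaceK, Submodule.baseChange_eq_span, Submodule.span_le]
  rintro _ ⟨a, ha, rfl⟩
  refine Module.End.mem_eigenspace_iff.2 ?_
  have hk := fun m => Module.End.mem_eigenspace_iff.1 ((Submodule.mem_iInf _).1 ha m).2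
  have h2 := hk 2
  have h2' := hk (-2)
  rw [ukUnit_zpow_two] at h2
  rw [ukUnit_zpow_neg_two] at h2'
  have e1 : ((2 : ℤ) : ℂ) * (α : ℂ) / 2 = α := by push_cast; ring
  have e2 : ((-2 : ℤ) : ℂ) * (α : ℂ) / 2 = -α := by push_cast; ring
  rw [e1] at h2
  rw [e2] at h2'
  rw [Z, map_add, atLam_tmul, atLam_tmul, map_add, LinearMap.add_apply, TensorProduct.mk_apply,
    actRight_tmul, actRight_tmul, map_sub, map_sub, regRight_one, LinearMap.sub_apply,
    LinearMap.sub_apply, h2, h2', Module.End.one_apply, nu_eq_zMinus_add_zPlus, map_add, map_smul,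
    map_smul]
  simp only [TensorProduct.tmul_sub, TensorProduct.tmul_smul]
  rw [add_smul, smul_assoc, smul_assoc]
  module

/-- The weight conditions involve all k^m, yet Z alone detects them: A_K is a sum of weight spaces
on which Z acts by scalars with invertible differences. The left action of Z isolates β, then the
right action isolates α. -/
lemma mem_weightSpaceK_iff {h : ℂ} (hq : ∀ n : ℕ, 0 < n → Complex.exp h ^ n ≠ 1) {α β : ℤ}
    {b : AK h} : b ∈ weightSpaceK h α β ↔
      actLeft h (atMu h (Z h)) b = inMu (nu h β) • b ∧
        actRight h (atLam h (Z h)) b = inLam (nu h α) • b := by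
  refine ⟨fun hb => ⟨actLeft_Z_weightSpaceK hb, actRight_Z_weightSpaceK hb⟩, fun hb => ?_⟩
  have h1 : b ∈ ⨆ α : ℤ, weightSpaceK h α β := by
    refine mem_of_mem_iSup_of_apply_eq (actLeft h (atMu h (Z h)))
      (fun β : ℤ => ⨆ α : ℤ, weightSpaceK h α β) (fun β => inMu (nu h β)) ?_ β
      (fun i hi => ?_) (by rw [iSup_weightSpaceK]; trivial) hb.1
    · intro i w hw
      have : ⨆ α : ℤ, weightSpaceK h α i ≤
          (actLeft h (atMu h (Z h))).eigenspace (inMu (nu h i)) :=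
        iSup_le fun α w hw => Module.End.mem_eigenspace_iff.2 (actLeft_Z_weightSpaceK hw)
      exact Module.End.mem_eigenspace_iff.1 (this hw)
    · rw [← map_sub]
      exact (isUnit_nu_sub hq hi).map inMu
  refine mem_of_mem_iSup_of_apply_eq (actRight h (atLam h (Z h)))
    (fun α : ℤ => weightSpaceK h α β) (fun α => inLam (nu h α))
    (fun i w hw => actRight_Z_weightSpaceK hw) α (fun i hi => ?_) h1 hb.2
  rw [← map_sub]
  exact (isUnit_nu_sub hq hi).map inLam

/-! ### Transport of the eigenspaces by x -/

lemma mem_bigradedPiece_iff {h : ℂ} (hq : ∀ n : ℕ, 0 < n → Complex.exp h ^ n ≠ 1) {α β : ℤ}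
    {a : AK h} : a ∈ bigradedPiece h hq α β ↔
      actLeft h (atMu h (Y h)) a = inMu (nu h β) • a ∧
        actRight h (atLam h (Y h)) a = inLam (nu h α) • a := by
  obtain ⟨X, hX⟩ := isUnit_xLeft h hq
  obtain ⟨X', hX'⟩ := isUnit_xRight h hq
  let C : (Module.End Coef (AK h))ˣ := X⁻¹ * X'
  have hC : Ring.inverse (xLeft h hq) * xRight h hq = C := by
    rw [← hX, ← hX', Ring.inverse_unit]
    rfl
  have cL : Commute (actRight h (atLam h (Y h))) (X : Module.End Coef (AK h)) := by
    rw [hX]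
    exact commute_locSum _ _ _ fun p => (commute_actLeft_actRight h _ _).symm
  have cR : Commute (actLeft h (atMu h (Z h))) (X' : Module.End Coef (AK h)) := by
    rw [hX']
    exact commute_locSum _ _ _ fun p => commute_actLeft_actRight h _ _
  -- x(μ) intertwines Y(μ) with Z(μ), while x(λ) acts from the other side and commutes with Z(μ);
  -- `eR` is the mirror image.
  have eL : actLeft h (atMu h (Y h)) * C = C * actLeft h (atMu h (Z h)) := by
    have h1 := xLeft_mul_Y h hq
    rw [← hX] at h1
    have h2 : actLeft h (atMu h (Y h)) * (↑X⁻¹ : Module.End Coef (AK h)) =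
        ↑X⁻¹ * actLeft h (atMu h (Z h)) := by
      rw [Units.mul_inv_eq_iff_eq_mul, mul_assoc, ← h1, Units.inv_mul_cancel_left]
    rw [Units.val_mul, ← mul_assoc, h2, mul_assoc, cR.eq, mul_assoc]
  have eR : actRight h (atLam h (Y h)) * C = C * actRight h (atLam h (Z h)) := by
    have h1 := Y_mul_xRight h hq
    rw [← hX'] at h1
    rw [Units.val_mul, ← mul_assoc, cL.units_inv_right.eq, mul_assoc, h1, mul_assoc]
  have hinj : Function.Injective (C : Module.End Coef (AK h)) :=
    ((Module.End.isUnit_iff _).1 C.isUnit).1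
  have key : ∀ b : AK h, (actLeft h (atMu h (Y h)) (C.val b) = inMu (nu h β) • C.val b ∧
      actRight h (atLam h (Y h)) (C.val b) = inLam (nu h α) • C.val b) ↔
        b ∈ weightSpaceK h α β := by
    intro b
    rw [mem_weightSpaceK_iff hq, ← Module.End.mul_apply, eL, ← Module.End.mul_apply, eR,
      Module.End.mul_apply, Module.End.mul_apply, ← map_smul, ← map_smul, hinj.eq_iff, hinj.eq_iff]
  rw [bigradedPiece, hC, Submodule.mem_map]
  constructor
  · rintro ⟨b, hb, rfl⟩
    exact (key b).2 hb
  · intro ha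
    obtain ⟨b, rfl⟩ := ((Module.End.isUnit_iff _).1 C.isUnit).2 a
    exact ⟨b, (key b).1 ha, rfl⟩

end

end SL2Dyn

theorem mainTheorem4 (h : ℂ) (hq : ∀ n : ℕ, 0 < n → Complex.exp h ^ n ≠ 1) :
    IsUnit (SL2Dyn.xLeft h hq) ∧ IsUnit (SL2Dyn.xRight h hq) ∧
    ∀ α β : ℤ, (SL2Dyn.bigradedPiece h hq α β : Set (SL2Dyn.AK h)) =
      {a | SL2Dyn.actLeft h (SL2Dyn.atMu h (SL2Dyn.Y h)) a
              = SL2Dyn.inMu (SL2Dyn.nu h β) • a ∧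
           SL2Dyn.actRight h (SL2Dyn.atLam h (SL2Dyn.Y h)) a
              = SL2Dyn.inLam (SL2Dyn.nu h α) • a} :=
  ⟨SL2Dyn.isUnit_xLeft h hq, SL2Dyn.isUnit_xRight h hq, fun _ _ =>
    Set.ext fun _ => SL2Dyn.mem_bigradedPiece_iff hq⟩
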